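/- Let $\Omega\subset\mathbb{R}^n$ be a bounded Lipschitz domain (for instance a polygonal or polyhedral one with $n\in\{2,3\}$), and let $\mathcal{T}$ be a finite mesh of pairwise disjoint open Lipschitz elements $T\subset\Omega$ with $\bar\Omega=\bigcup_{T\in\mathcal{T}}\bar T$. Let $f\in L_2(\Omega)$. Assume that $d>0$ is such that the Poincaré–Friedrichs inequality $\|v\|\le d\,\|\nabla v\|$ holds for all $v\in H^1_0(\Omega)$, where $\|\cdot\|$ is the $L_2(\Omega)$-norm. *Spaces.* Let $H^1(\mathcal{T})=\prod_{T}H^1(T)$, $H(\mathrm{div},\mathcal{T})=\prod_T H(\mathrm{div},T)$ and $V=H^1(\mathcal{T})\times H(\mathrm{div},\mathcal{T})$. Write $(\cdot,\cdot)_{\mathcal{T}}$ for the $L_2$-inner product with differential operators taken elementwise. Define the trace operators $\mathrm{tr}:H^1(\mathcal{T})\to H(\mathrm{div},\mathcal{T})'$ and $\mathrm{tr}^{\mathrm{div}}:H(\mathrm{div},\mathcal{T})\to H^1(\mathcal{T})'$ by $$\langle \mathrm{tr}(v),\delta\tau\rangle_{\mathcal S}=(v,\operatorname{div}\delta\tau)_{\mathcal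 T}+(\nabla v,\delta\tau)_{\mathcal T},\qquad \langle \mathrm{tr}^{\mathrm{div}}(\tau),\delta v\rangle_{\mathcal S}=(\tau,\nabla\delta v)_{\mathcal T}+(\operatorname{div}\tau,\delta v)_{\mathcal T},$$ and set $U=L_2(\Omega)\times L_2(\Omega)^n\times \mathrm{tr}(H^1_0(\Omega))\times \mathrm{tr}^{\mathrm{div}}(H(\mathrm{div},\Omega))$. For $\boldsymbol u=(u,\sigma,\hat u,\hat\sigma)\in U$ define $$\|\boldsymbol u\|_{U,d}^2=d^{-2}\|u\|^2+\|\sigma\|^2+\|\hat u\|_{1/2,d,\mathcal S}^2+\|\hat\sigma\|_{-1/2,d,\mathcal S}^2,$$ $$\|\hat u\|_{1/2,d,\mathcal S}=\inf\{(d^{-2}\|v\|^2+\|\nabla v\|^2)^{1/2};\ v\in H^1(\Omega),\ \mathrm{tr}(v)=\hat u\},$$ $$\|\hat\sigma\|_{-1/2,d,\mathcal S}=\inf\{(\|\tau\|^2+d^2\|\operatorname{div}\tau\|^2)^{1/2};\ \tau\in H(\mathrm{div},\Omega),\ \mathrm{tr}^{\mathrm{div}}(\tau)=\hat\sigma\}.$$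 *Ultraweak formulation* of $-\Delta u=f$ in $\Omega$, $u=0$ on $\partial\Omega$: find $\boldsymbol u=(u,\sigma,\hat u,\hat\sigma)\in U$ such that, for all $\boldsymbol v=(v,\tau)\in V$, $$b(\boldsymbol u,\boldsymbol v):=(u,\operatorname{div}\tau)_{\mathcal T}+(\sigma,\tau+\nabla v)_{\mathcal T}-\langle\hat u,\tau\rangle_{\mathcal S}-\langle\hat\sigma,v\rangle_{\mathcal S}=(f,v)=:L(\boldsymbol v).$$ *DPG scheme.* Let $\Theta_d:U\to V$ be defined by $\langle\Theta_d\boldsymbol w,\boldsymbol v\rangle_{V,d}=b(\boldsymbol w,\boldsymbol v)$ for all $\boldsymbol v\in V$, where $$\langle (v,\tau),(\delta v,\delta\tau)\rangle_{V,d}=d^{-2}(v,\delta v)+(\nabla v,\nabla\delta v)_{\mathcal T}+(\tau,\delta\tau)+d^2(\operatorname{div}\tau,\operatorname{div}\delta\tau)_{\mathcal T}.$$ Given a finite-dimensional subspace $U_h\subset U$, find $\boldsymbol u_h\in U_h$ with $b(\boldsymbol u_h,\boldsymbol v)=L(\boldsymbol v)$ for all $\boldsymbol v\in\Theta_d(U_h)$.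 **Theorem.** The ultraweak formulation has a unique solution $\boldsymbol u\in U$, the operator $\Theta_d$ is well defined (each $\boldsymbol w\in U$ has exactly one image $\Theta_d\boldsymbol w\in V$), the DPG scheme has a unique solution $\boldsymbol u_h\in U_h$, and $$\|\boldsymbol u-\boldsymbol u_h\|_{U,d}\le 9\,\inf\{\|\boldsymbol u-\boldsymbol w\|_{U,d};\ \boldsymbol w\in U_h\}.$$ -/

import Mathlib

open MeasureTheory Set
open scoped ContDiff

noncomputable section

namespace DPG

/-! ### Lipschitz domains and meshes -/

/-- The Euclidean space `ℝⁿ`. -/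
abbrev Eu (n : ℕ) : Type := EuclideanSpace ℝ (Fin n)

/-- Near each boundary point, after the choice of a direction `ν`, the set `D` is the region
strictly below the graph of a Lipschitz function `φ` of the coordinates orthogonal to `ν`. -/
def HasLipschitzBoundary {n : ℕ} (D : Set (Eu n)) : Prop :=
  ∀ x ∈ frontier D, ∃ ν : Eu n, ‖ν‖ = 1 ∧ ∃ (K : NNReal) (φ : Eu n → ℝ), LipschitzWith K φ ∧
    ∃ r : ℝ, 0 < r ∧ ∀ y ∈ Metric.ball x r,
      (y ∈ D ↔ inner ℝ ν y < φ (y - (inner ℝ ν y : ℝ) • ν))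

/-- Bounded Lipschitz domains of `ℝⁿ`. -/
structure IsLipschitzDomain {n : ℕ} (Ω : Set (Eu n)) : Prop where
  isOpen : IsOpen Ω
  isConnected : IsConnected Ω
  isBounded : Bornology.IsBounded Ω
  lipschitz : HasLipschitzBoundary Ω

/-- A mesh on `Ω`: a family of disjoint open Lipschitz elements `T i ⊆ Ω` whose
closures cover the closure of `Ω`. -/
structure IsMesh {n : ℕ} {ι : Type*} (Ω : Set (Eu n)) (T : ι → Set (Eu n)) : Prop where
  subset : ∀ i, T i ⊆ Ω
  isOpen : ∀ i, IsOpen (T i)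
  lipschitz : ∀ i, HasLipschitzBoundary (T i)
  disjoint : Pairwise (fun i j => Disjoint (T i) (T j))
  cover : closure Ω = ⋃ i, closure (T i)

/-! ### Lebesgue and Sobolev spaces -/

/-- The scalar space `L₂(D)`. -/
abbrev L2 {n : ℕ} (D : Set (Eu n)) := Lp ℝ 2 (volume.restrict D)

/-- The space `L₂(D)ⁿ` of vector fields. -/
abbrev L2v {n : ℕ} (D : Set (Eu n)) := Lp (Eu n) 2 (volume.restrict D)

/-- Smooth functions with compact support in `D`. -/
structure IsTestFunction {n : ℕ} (D : Set (Eu n)) (φ : Eu n → ℝ) : Prop where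
  smooth : ContDiff ℝ ∞ φ
  compact : HasCompactSupport φ
  support : tsupport φ ⊆ D

/-- `g` is the weak gradient of `v` on `D`. -/
def HasWeakGrad {n : ℕ} (D : Set (Eu n)) (v : L2 D) (g : L2v D) : Prop :=
  ∀ φ : Eu n → ℝ, IsTestFunction D φ →
    ∫ x in D, v x • gradient φ x = - ∫ x in D, φ x • g x

/-- `w` is the weak divergence of `τ` on `D`. -/
def HasWeakDiv {n : ℕ} (D : Set (Eu n)) (τ : L2v D) (w : L2 D) : Prop :=
  ∀ φ : Eu n → ℝ, IsTestFunction D φ →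
    ∫ x in D, (inner ℝ (τ x) (gradient φ x) : ℝ) = - ∫ x in D, w x * φ x

theorem IsTestFunction.memLp {n : ℕ} {D : Set (Eu n)} {φ : Eu n → ℝ} (h : IsTestFunction D φ) :
    MemLp φ 2 (volume.restrict D) :=
  (h.smooth.continuous.memLp_of_hasCompactSupport h.compact).restrict D

theorem IsTestFunction.memLp_gradient {n : ℕ} {D : Set (Eu n)} {φ : Eu n → ℝ}
    (h : IsTestFunction D φ) : MemLp (gradient φ) 2 (volume.restrict D) := by
  have hc : Continuous (gradient φ) :=
    (InnerProductSpace.toDual ℝ (Eu n)).symm.continuous.comp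
      (h.smooth.continuous_fderiv (by simp))
  have hs : HasCompactSupport (gradient φ) :=
    (h.compact.fderiv (𝕜 := ℝ)).comp_left (g := (InnerProductSpace.toDual ℝ (Eu n)).symm)
      (map_zero _)
  exact (hc.memLp_of_hasCompactSupport hs).restrict D

theorem IsTestFunction.integrable_inner {n : ℕ} {D : Set (Eu n)} {φ : Eu n → ℝ}
    (h : IsTestFunction D φ) {g : Eu n → Eu n} (hg : MemLp g 2 (volume.restrict D)) :
    Integrable (fun x => (inner ℝ (g x) (gradient φ x) : ℝ)) (volume.restrict D) := by
  refine (hg.norm.integrable_mul h.memLp_gradient.norm).mono'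
    (hg.aestronglyMeasurable.inner h.memLp_gradient.aestronglyMeasurable) ?_
  filter_upwards with x
  exact norm_inner_le_norm _ _

/-- `H¹(D)`, each function being paired with its (unique) weak gradient:
an element `v` consists of the function `v.1.1` and of the field `v.1.2 = ∇v`. -/
def H1 {n : ℕ} (D : Set (Eu n)) : Submodule ℝ (L2 D × L2v D) where
  carrier := {p | HasWeakGrad D p.1 p.2}
  zero_mem' := by
    intro φ hφ
    have h1 : ∫ x in D, ((0 : L2 D) x) • gradient φ x = 0 := by
      rw [integral_congr_ae (g := fun _ => (0 : Eu n)), integral_zero]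
      filter_upwards [Lp.coeFn_zero ℝ 2 (volume.restrict D)] with x hx
      rw [hx, Pi.zero_apply, zero_smul]
    have h2 : ∫ x in D, φ x • ((0 : L2v D) x) = 0 := by
      rw [integral_congr_ae (g := fun _ => (0 : Eu n)), integral_zero]
      filter_upwards [Lp.coeFn_zero (Eu n) 2 (volume.restrict D)] with x hx
      rw [hx, Pi.zero_apply, smul_zero]
    simp only [Prod.fst_zero, Prod.snd_zero]
    rw [h1, h2, neg_zero]
  add_mem' := by
    rintro ⟨v, g⟩ ⟨v', g'⟩ h h' φ hφ
    have h1 : ∫ x in D, ((v + v' : L2 D) x) • gradient φ x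
        = (∫ x in D, v x • gradient φ x) + ∫ x in D, v' x • gradient φ x := by
      rw [← integral_add]
      · refine integral_congr_ae ?_
        filter_upwards [Lp.coeFn_add v v'] with x hx
        rw [hx, Pi.add_apply, add_smul]
      · exact memLp_one_iff_integrable.1 (hφ.memLp_gradient.smul (Lp.memLp v))
      · exact memLp_one_iff_integrable.1 (hφ.memLp_gradient.smul (Lp.memLp v'))
    have h2 : ∫ x in D, φ x • ((g + g' : L2v D) x)
        = (∫ x in D, φ x • g x) + ∫ x in D, φ x • g' x := by
      rw [← integral_add]
      · refine integral_congr_ae ?_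
        filter_upwards [Lp.coeFn_add g g'] with x hx
        rw [hx, Pi.add_apply, smul_add]
      · exact memLp_one_iff_integrable.1 ((Lp.memLp g).smul hφ.memLp)
      · exact memLp_one_iff_integrable.1 ((Lp.memLp g').smul hφ.memLp)
    have e := h φ hφ
    have e' := h' φ hφ
    simp only [Prod.mk_add_mk] at *
    rw [h1, h2, e, e', neg_add]
  smul_mem' := by
    rintro c ⟨v, g⟩ h φ hφ
    have h1 : ∫ x in D, ((c • v : L2 D) x) • gradient φ x
        = c • ∫ x in D, v x • gradient φ x := by
      rw [← integral_smul]
      refine integral_congr_ae ?_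
      filter_upwards [Lp.coeFn_smul c v] with x hx
      simp [hx, smul_smul]
    have h2 : ∫ x in D, φ x • ((c • g : L2v D) x) = c • ∫ x in D, φ x • g x := by
      rw [← integral_smul]
      refine integral_congr_ae ?_
      filter_upwards [Lp.coeFn_smul c g] with x hx
      simp only [hx, Pi.smul_apply]
      rw [smul_comm]
    have e := h φ hφ
    simp only [Prod.smul_mk] at *
    rw [h1, h2, e, smul_neg]

/-- `H(div, D)`, each field being paired with its (unique) weak divergence:
an element `τ` consists of the field `τ.1.1` and of the function `τ.1.2 = div τ`. -/
def Hdiv {n : ℕ} (D : Set (Eu n)) : Submodule ℝ (L2v D × L2 D) where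
  carrier := {p | HasWeakDiv D p.1 p.2}
  zero_mem' := by
    intro φ hφ
    have h1 : ∫ x in D, (inner ℝ ((0 : L2v D) x) (gradient φ x) : ℝ) = 0 := by
      rw [integral_congr_ae (g := fun _ => (0 : ℝ)), integral_zero]
      filter_upwards [Lp.coeFn_zero (Eu n) 2 (volume.restrict D)] with x hx
      rw [hx, Pi.zero_apply, inner_zero_left]
    have h2 : ∫ x in D, ((0 : L2 D) x) * φ x = 0 := by
      rw [integral_congr_ae (g := fun _ => (0 : ℝ)), integral_zero]
      filter_upwards [Lp.coeFn_zero ℝ 2 (volume.restrict D)] with x hx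
      rw [hx, Pi.zero_apply, zero_mul]
    simp only [Prod.fst_zero, Prod.snd_zero]
    rw [h1, h2, neg_zero]
  add_mem' := by
    rintro ⟨g, v⟩ ⟨g', v'⟩ h h' φ hφ
    have h1 : ∫ x in D, (inner ℝ ((g + g' : L2v D) x) (gradient φ x) : ℝ)
        = (∫ x in D, (inner ℝ (g x) (gradient φ x) : ℝ))
          + ∫ x in D, (inner ℝ (g' x) (gradient φ x) : ℝ) := by
      rw [← integral_add]
      · refine integral_congr_ae ?_
        filter_upwards [Lp.coeFn_add g g'] with x hx
        rw [hx, Pi.add_apply, inner_add_left]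
      · exact hφ.integrable_inner (Lp.memLp g)
      · exact hφ.integrable_inner (Lp.memLp g')
    have h2 : ∫ x in D, ((v + v' : L2 D) x) * φ x
        = (∫ x in D, v x * φ x) + ∫ x in D, v' x * φ x := by
      rw [← integral_add]
      · refine integral_congr_ae ?_
        filter_upwards [Lp.coeFn_add v v'] with x hx
        rw [hx, Pi.add_apply, add_mul]
      · exact (Lp.memLp v).integrable_mul hφ.memLp
      · exact (Lp.memLp v').integrable_mul hφ.memLp
    have e := h φ hφ
    have e' := h' φ hφ
    simp only [Prod.mk_add_mk] at *
    rw [h1, h2, e, e', neg_add]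
  smul_mem' := by
    rintro c ⟨g, v⟩ h φ hφ
    have h1 : ∫ x in D, (inner ℝ ((c • g : L2v D) x) (gradient φ x) : ℝ)
        = c • ∫ x in D, (inner ℝ (g x) (gradient φ x) : ℝ) := by
      rw [← integral_smul]
      refine integral_congr_ae ?_
      filter_upwards [Lp.coeFn_smul c g] with x hx
      rw [hx, Pi.smul_apply, inner_smul_left]; rfl
    have h2 : ∫ x in D, ((c • v : L2 D) x) * φ x = c • ∫ x in D, v x * φ x := by
      rw [← integral_smul]
      refine integral_congr_ae ?_
      filter_upwards [Lp.coeFn_smul c v] with x hx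
      simp [hx, mul_assoc]
    have e := h φ hφ
    simp only [Prod.smul_mk] at *
    rw [h1, h2, e, smul_neg]

instance {n : ℕ} (D : Set (Eu n)) : NormedAddCommGroup (H1 D) :=
  Submodule.normedAddCommGroup (H1 D)

instance {n : ℕ} (D : Set (Eu n)) : NormedSpace ℝ (H1 D) :=
  Submodule.normedSpace (H1 D)

instance {n : ℕ} (D : Set (Eu n)) : NormedAddCommGroup (Hdiv D) :=
  Submodule.normedAddCommGroup (Hdiv D)

instance {n : ℕ} (D : Set (Eu n)) : NormedSpace ℝ (Hdiv D) :=
  Submodule.normedSpace (Hdiv D)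

/-- `H¹₀(D)`: the closure in `H¹(D)` of the smooth functions with compact support in `D`. -/
def H10 {n : ℕ} (D : Set (Eu n)) : Submodule ℝ (H1 D) :=
  (Submodule.span ℝ {v : H1 D | ∃ φ : Eu n → ℝ, IsTestFunction D φ ∧
    v.1.1 =ᵐ[volume.restrict D] φ ∧
    v.1.2 =ᵐ[volume.restrict D] gradient φ}).topologicalClosure

/-- The Poincaré–Friedrichs inequality on `Ω` with constant `d`. -/
def PoincareFriedrichs {n : ℕ} (Ω : Set (Eu n)) (d : ℝ) : Prop :=
  ∀ v ∈ H10 Ω, ‖v.1.1‖ ≤ d * ‖v.1.2‖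

/-! ### Restriction to elements and broken spaces -/

/-- Restriction of square integrable functions from `Ω` to a subset `D`. -/
def restrictLp {n : ℕ} {F : Type*} [NormedAddCommGroup F] [NormedSpace ℝ F]
    {Ω D : Set (Eu n)} (h : D ⊆ Ω) :
    Lp F 2 (volume.restrict Ω) →ₗ[ℝ] Lp F 2 (volume.restrict D) where
  toFun v := ((Lp.memLp v).mono_measure (Measure.restrict_mono_set volume h)).toLp v
  map_add' v w := by
    rw [← MemLp.toLp_add]
    refine MemLp.toLp_congr _ _ ?_
    exact ae_mono (Measure.restrict_mono_set volume h) (Lp.coeFn_add v w)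
  map_smul' c v := by
    simp only [RingHom.id_apply]
    rw [← MemLp.toLp_const_smul]
    refine MemLp.toLp_congr _ _ ?_
    exact ae_mono (Measure.restrict_mono_set volume h) (Lp.coeFn_smul c v)

theorem restrictLp_coeFn {n : ℕ} {F : Type*} [NormedAddCommGroup F] [NormedSpace ℝ F]
    {Ω D : Set (Eu n)} (h : D ⊆ Ω) (v : Lp F 2 (volume.restrict Ω)) :
    restrictLp h v =ᵐ[volume.restrict D] v :=
  MemLp.coeFn_toLp ((Lp.memLp v).mono_measure (Measure.restrict_mono_set volume h))

theorem IsTestFunction.mono {n : ℕ} {Ω D : Set (Eu n)} (h : D ⊆ Ω) {φ : Eu n → ℝ}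
    (hφ : IsTestFunction D φ) : IsTestFunction Ω φ :=
  ⟨hφ.smooth, hφ.compact, hφ.support.trans h⟩

theorem IsTestFunction.eq_zero {n : ℕ} {D : Set (Eu n)} {φ : Eu n → ℝ}
    (hφ : IsTestFunction D φ) {x : Eu n} (hx : x ∉ D) : φ x = 0 :=
  image_eq_zero_of_notMem_tsupport fun hx' => hx (hφ.support hx')

theorem IsTestFunction.gradient_eq_zero {n : ℕ} {D : Set (Eu n)} {φ : Eu n → ℝ}
    (hφ : IsTestFunction D φ) {x : Eu n} (hx : x ∉ D) : gradient φ x = 0 := by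
  have : fderiv ℝ φ x = 0 := by
    by_contra hne
    exact hx (hφ.support (support_fderiv_subset ℝ hne))
  simp [gradient, this]

theorem setIntegral_eq_of_subset {n : ℕ} {F : Type*} [NormedAddCommGroup F] [NormedSpace ℝ F]
    {Ω D : Set (Eu n)} (h : D ⊆ Ω) {g : Eu n → F} (hg : ∀ x, x ∉ D → g x = 0) :
    ∫ x in D, g x = ∫ x in Ω, g x := by
  rw [setIntegral_eq_integral_of_forall_compl_eq_zero hg,
    setIntegral_eq_integral_of_forall_compl_eq_zero fun x hx => hg x fun hx' => hx (h hx')]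

/-- Restriction `H¹(Ω) → H¹(D)`. -/
def restrictH1 {n : ℕ} {Ω D : Set (Eu n)} (h : D ⊆ Ω) : H1 Ω →ₗ[ℝ] H1 D :=
  ((restrictLp h).prodMap (restrictLp h)).restrict (by
    rintro ⟨v, g⟩ hp φ hφ
    have e := hp φ (hφ.mono h)
    simp only [LinearMap.prodMap_apply] at *
    have h1 : ∫ x in D, (restrictLp h v) x • gradient φ x = ∫ x in Ω, v x • gradient φ x := by
      rw [← setIntegral_eq_of_subset (Ω := Ω) h
        (fun x hx => by simp [hφ.gradient_eq_zero hx])]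
      refine integral_congr_ae ?_
      filter_upwards [restrictLp_coeFn h v] with x hx
      rw [hx]
    have h2 : ∫ x in D, φ x • (restrictLp h g) x = ∫ x in Ω, φ x • g x := by
      rw [← setIntegral_eq_of_subset (Ω := Ω) h
        (fun x hx => by simp [hφ.eq_zero hx])]
      refine integral_congr_ae ?_
      filter_upwards [restrictLp_coeFn h g] with x hx
      rw [hx]
    rw [h1, h2, e])

/-- Restriction `H(div, Ω) → H(div, D)`. -/
def restrictHdiv {n : ℕ} {Ω D : Set (Eu n)} (h : D ⊆ Ω) : Hdiv Ω →ₗ[ℝ] Hdiv D :=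
  ((restrictLp h).prodMap (restrictLp h)).restrict (by
    rintro ⟨g, v⟩ hp φ hφ
    have e := hp φ (hφ.mono h)
    simp only [LinearMap.prodMap_apply] at *
    have h1 : ∫ x in D, (inner ℝ ((restrictLp h g) x) (gradient φ x) : ℝ)
        = ∫ x in Ω, (inner ℝ (g x) (gradient φ x) : ℝ) := by
      rw [← setIntegral_eq_of_subset (Ω := Ω) h
        (fun x hx => by simp [hφ.gradient_eq_zero hx])]
      refine integral_congr_ae ?_
      filter_upwards [restrictLp_coeFn h g] with x hx
      rw [hx]
    have h2 : ∫ x in D, (restrictLp h v) x * φ x = ∫ x in Ω, v x * φ x := by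
      rw [← setIntegral_eq_of_subset (Ω := Ω) h
        (fun x hx => by simp [hφ.eq_zero hx])]
      refine integral_congr_ae ?_
      filter_upwards [restrictLp_coeFn h v] with x hx
      rw [hx]
    rw [h1, h2, e])

/-- The broken space `H¹(𝒯) = ∏ H¹(T)`. -/
abbrev BrokenH1 {n : ℕ} {ι : Type*} (T : ι → Set (Eu n)) := ∀ i, H1 (T i)

/-- The broken space `H(div, 𝒯) = ∏ H(div, T)`. -/
abbrev BrokenHdiv {n : ℕ} {ι : Type*} (T : ι → Set (Eu n)) := ∀ i, Hdiv (T i)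

/-- Elementwise restriction `H¹(Ω) → H¹(𝒯)`. -/
def toBrokenH1 {n : ℕ} {ι : Type*} {Ω : Set (Eu n)} {T : ι → Set (Eu n)} (hT : IsMesh Ω T) :
    H1 Ω →ₗ[ℝ] BrokenH1 T :=
  LinearMap.pi fun i => restrictH1 (hT.subset i)

/-- Elementwise restriction `H(div, Ω) → H(div, 𝒯)`. -/
def toBrokenHdiv {n : ℕ} {ι : Type*} {Ω : Set (Eu n)} {T : ι → Set (Eu n)} (hT : IsMesh Ω T) :
    Hdiv Ω →ₗ[ℝ] BrokenHdiv T :=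
  LinearMap.pi fun i => restrictHdiv (hT.subset i)

/-! ### Trace operators and trace spaces -/

/-- The local trace `H¹(D) → (H(div, D))'`, `v ↦ (δτ ↦ (v, div δτ) + (∇v, δτ))`. -/
def traceGradLoc {n : ℕ} (D : Set (Eu n)) : H1 D →ₗ[ℝ] (Hdiv D →L[ℝ] ℝ) where
  toFun v := (innerSL ℝ v.1.1).comp ((ContinuousLinearMap.snd ℝ _ _).comp (Hdiv D).subtypeL)
    + (innerSL ℝ v.1.2).comp ((ContinuousLinearMap.fst ℝ _ _).comp (Hdiv D).subtypeL)
  map_add' v w := by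
    ext τ
    simp
    ring
  map_smul' c v := by
    ext τ
    simp

/-- The local trace `H(div, D) → (H¹(D))'`, `τ ↦ (δv ↦ (τ, ∇δv) + (div τ, δv))`. -/
def traceDivLoc {n : ℕ} (D : Set (Eu n)) : Hdiv D →ₗ[ℝ] (H1 D →L[ℝ] ℝ) where
  toFun τ := (innerSL ℝ τ.1.1).comp ((ContinuousLinearMap.snd ℝ _ _).comp (H1 D).subtypeL)
    + (innerSL ℝ τ.1.2).comp ((ContinuousLinearMap.fst ℝ _ _).comp (H1 D).subtypeL)
  map_add' v w := by
    ext τ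
    simp
    ring
  map_smul' c v := by
    ext τ
    simp

/-- The product trace `H¹(𝒯) → (H(div, 𝒯))'`: the sum of the local traces. -/
def traceGrad {n : ℕ} {ι : Type*} [Fintype ι] (T : ι → Set (Eu n)) :
    BrokenH1 T →ₗ[ℝ] (BrokenHdiv T →L[ℝ] ℝ) where
  toFun v := ∑ i, (traceGradLoc (T i) (v i)).comp (ContinuousLinearMap.proj i)
  map_add' v w := by
    ext τ
    simp [Finset.sum_add_distrib]
  map_smul' c v := by
    ext τ
    simp [Finset.mul_sum]

/-- The product trace `H(div, 𝒯) → (H¹(𝒯))'`: the sum of the local traces. -/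
def traceDiv {n : ℕ} {ι : Type*} [Fintype ι] (T : ι → Set (Eu n)) :
    BrokenHdiv T →ₗ[ℝ] (BrokenH1 T →L[ℝ] ℝ) where
  toFun τ := ∑ i, (traceDivLoc (T i) (τ i)).comp (ContinuousLinearMap.proj i)
  map_add' v w := by
    ext τ
    simp [Finset.sum_add_distrib]
  map_smul' c v := by
    ext τ
    simp [Finset.mul_sum]

/-- The trace of functions of `H¹(Ω)` on the skeleton. -/
def skelGrad {n : ℕ} {ι : Type*} [Fintype ι] {Ω : Set (Eu n)} {T : ι → Set (Eu n)}
    (hT : IsMesh Ω T) : H1 Ω →ₗ[ℝ] (BrokenHdiv T →L[ℝ] ℝ) :=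
  traceGrad T ∘ₗ toBrokenH1 hT

/-- The (normal) trace of fields of `H(div, Ω)` on the skeleton. -/
def skelDiv {n : ℕ} {ι : Type*} [Fintype ι] {Ω : Set (Eu n)} {T : ι → Set (Eu n)}
    (hT : IsMesh Ω T) : Hdiv Ω →ₗ[ℝ] (BrokenH1 T →L[ℝ] ℝ) :=
  traceDiv T ∘ₗ toBrokenHdiv hT

/-- The trace space `H^{1/2}(𝒮)`, the image of `H¹₀(Ω)`. The duality `⟨û, τ⟩_𝒮` is `û τ`. -/
def TrGrad {n : ℕ} {ι : Type*} [Fintype ι] {Ω : Set (Eu n)} {T : ι → Set (Eu n)}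
    (hT : IsMesh Ω T) : Submodule ℝ (BrokenHdiv T →L[ℝ] ℝ) :=
  (H10 Ω).map (skelGrad hT)

/-- The trace space `H^{-1/2}(𝒮)`, the image of `H(div, Ω)`. The duality `⟨σ̂, v⟩_𝒮` is `σ̂ v`. -/
def TrDiv {n : ℕ} {ι : Type*} [Fintype ι] {Ω : Set (Eu n)} {T : ι → Set (Eu n)}
    (hT : IsMesh Ω T) : Submodule ℝ (BrokenH1 T →L[ℝ] ℝ) :=
  LinearMap.range (skelDiv hT)

instance {n : ℕ} {ι : Type*} [Fintype ι] {Ω : Set (Eu n)} {T : ι → Set (Eu n)}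
    (hT : IsMesh Ω T) : AddCommGroup (TrGrad hT) := (TrGrad hT).addCommGroup

instance {n : ℕ} {ι : Type*} [Fintype ι] {Ω : Set (Eu n)} {T : ι → Set (Eu n)}
    (hT : IsMesh Ω T) : Module ℝ (TrGrad hT) := (TrGrad hT).module

instance {n : ℕ} {ι : Type*} [Fintype ι] {Ω : Set (Eu n)} {T : ι → Set (Eu n)}
    (hT : IsMesh Ω T) : AddCommGroup (TrDiv hT) := (TrDiv hT).addCommGroup

instance {n : ℕ} {ι : Type*} [Fintype ι] {Ω : Set (Eu n)} {T : ι → Set (Eu n)}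
    (hT : IsMesh Ω T) : Module ℝ (TrDiv hT) := (TrDiv hT).module

/-! ### Trial and test spaces with their scaled norms -/

/-- The trial space; an element `u` consists of the function `u.1`, the field `u.2.1 = σ`, and
the traces `u.2.2.1 = û`, `u.2.2.2 = σ̂`. -/
abbrev TrialSpace {n : ℕ} {ι : Type*} [Fintype ι] {Ω : Set (Eu n)} {T : ι → Set (Eu n)}
    (hT : IsMesh Ω T) :=
  L2 Ω × L2v Ω × TrGrad hT × TrDiv hT

/-- The broken test space; an element `v` consists of `v.1 ∈ H¹(𝒯)` and
`v.2 = τ ∈ H(div, 𝒯)`. -/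
abbrev TestSpace {n : ℕ} {ι : Type*} (T : ι → Set (Eu n)) := BrokenH1 T × BrokenHdiv T

/-- The norm `‖v‖_{1,d} = (d⁻²‖v‖² + ‖∇v‖²)^{1/2}` of `H¹(Ω)`. -/
def normH1 {n : ℕ} {Ω : Set (Eu n)} (d : ℝ) (v : H1 Ω) : ℝ :=
  √((d ^ 2)⁻¹ * ‖v.1.1‖ ^ 2 + ‖v.1.2‖ ^ 2)

/-- The norm `‖τ‖_{div,d} = (‖τ‖² + d²‖div τ‖²)^{1/2}` of `H(div, Ω)`. -/
def normHdiv {n : ℕ} {Ω : Set (Eu n)} (d : ℝ) (τ : Hdiv Ω) : ℝ :=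
  √(‖τ.1.1‖ ^ 2 + d ^ 2 * ‖τ.1.2‖ ^ 2)

/-- The minimum energy extension norm `‖û‖_{1/2,d,𝒮}`. -/
def normTrGrad {n : ℕ} {ι : Type*} [Fintype ι] {Ω : Set (Eu n)} {T : ι → Set (Eu n)}
    (hT : IsMesh Ω T) (d : ℝ) (w : TrGrad hT) : ℝ :=
  sInf (normH1 d '' {v : H1 Ω | skelGrad hT v = w})

/-- The minimum energy extension norm `‖σ̂‖_{-1/2,d,𝒮}`. -/
def normTrDiv {n : ℕ} {ι : Type*} [Fintype ι] {Ω : Set (Eu n)} {T : ι → Set (Eu n)}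
    (hT : IsMesh Ω T) (d : ℝ) (w : TrDiv hT) : ℝ :=
  sInf (normHdiv d '' {τ : Hdiv Ω | skelDiv hT τ = w})

/-- The scaled norm `‖·‖_{U,d}` of the trial space. -/
def normU {n : ℕ} {ι : Type*} [Fintype ι] {Ω : Set (Eu n)} {T : ι → Set (Eu n)}
    (hT : IsMesh Ω T) (d : ℝ) (u : TrialSpace hT) : ℝ :=
  √((d ^ 2)⁻¹ * ‖u.1‖ ^ 2 + ‖u.2.1‖ ^ 2
    + normTrGrad hT d u.2.2.1 ^ 2 + normTrDiv hT d u.2.2.2 ^ 2)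

/-- The scaled inner product of the test space:
`d⁻²(v, δv) + (∇v, ∇δv) + (τ, δτ) + d²(div τ, div δτ)`, taken piecewise. -/
def innerV {n : ℕ} {ι : Type*} [Fintype ι] (T : ι → Set (Eu n)) (d : ℝ)
    (v w : TestSpace T) : ℝ :=
  ∑ i, ((d ^ 2)⁻¹ * inner ℝ (v.1 i).1.1 (w.1 i).1.1 + inner ℝ (v.1 i).1.2 (w.1 i).1.2
    + inner ℝ (v.2 i).1.1 (w.2 i).1.1 + d ^ 2 * inner ℝ (v.2 i).1.2 (w.2 i).1.2)

/-! ### The ultraweak formulation and the DPG scheme -/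

/-- The bilinear form of the ultraweak formulation of the Poisson problem,
`(u, div τ)_𝒯 + (σ, τ + ∇v)_𝒯 - ⟨û, τ⟩_𝒮 - ⟨σ̂, v⟩_𝒮`. -/
def bilinB {n : ℕ} {ι : Type*} [Fintype ι] {Ω : Set (Eu n)} {T : ι → Set (Eu n)}
    (hT : IsMesh Ω T) (u : TrialSpace hT) (v : TestSpace T) : ℝ :=
  (∑ i, (inner ℝ (restrictLp (hT.subset i) u.1) (v.2 i).1.2
    + inner ℝ (restrictLp (hT.subset i) u.2.1) ((v.2 i).1.1 + (v.1 i).1.2)))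
  - u.2.2.1.1 v.2 - u.2.2.2.1 v.1

/-- The load functional `L(v, τ) = (f, v)`. -/
def load {n : ℕ} {ι : Type*} [Fintype ι] {Ω : Set (Eu n)} {T : ι → Set (Eu n)}
    (hT : IsMesh Ω T) (f : L2 Ω) (v : TestSpace T) : ℝ :=
  ∑ i, inner ℝ (restrictLp (hT.subset i) f) (v.1 i).1.1

/-- `u` solves the ultraweak formulation with right-hand side `f`. -/
def IsUltraweakSolution {n : ℕ} {ι : Type*} [Fintype ι] {Ω : Set (Eu n)} {T : ι → Set (Eu n)}
    (hT : IsMesh Ω T) (f : L2 Ω) (u : TrialSpace hT) : Prop :=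
  ∀ v : TestSpace T, bilinB hT u v = load hT f v

/-- `θ` is the optimal test function `Θ_d w` of `w` (trial-to-test operator). -/
def IsOptimalTest {n : ℕ} {ι : Type*} [Fintype ι] {Ω : Set (Eu n)} {T : ι → Set (Eu n)}
    (hT : IsMesh Ω T) (d : ℝ) (w : TrialSpace hT) (θ : TestSpace T) : Prop :=
  ∀ v : TestSpace T, innerV T d θ v = bilinB hT w v

/-- `uh` solves the DPG scheme: `uh ∈ U_h` and `b(uh, θ) = L(θ)` for all `θ ∈ Θ_d(U_h)`. -/
def IsDPGSolution {n : ℕ} {ι : Type*} [Fintype ι] {Ω : Set (Eu n)} {T : ι → Set (Eu n)}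
    (hT : IsMesh Ω T) (d : ℝ) (f : L2 Ω) (Uh : Submodule ℝ (TrialSpace hT))
    (uh : TrialSpace hT) : Prop :=
  uh ∈ Uh ∧ ∀ w ∈ Uh, ∀ θ : TestSpace T, IsOptimalTest hT d w θ → bilinB hT uh θ = load hT f θ

end DPG

end

open scoped Pointwise

noncomputable section

namespace DPG

section

variable {n : ℕ} {D Ω : Set (Eu n)} {φ ψ : Eu n → ℝ}

/-! ### Test functions as elements of the Sobolev spaces -/

/-! The DPG scheme is a minimum residual method. Since `b(w, Θw') = ⟨Θw, Θw'⟩` is symmetric in `w`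
and `w'`, the discrete equations say that `u - uh` is orthogonal to `U_h` for the energy product
`⟨Θ·, Θ·⟩`, so `uh` is the best approximation of `u` in the energy norm (`existsUnique_galerkin`).
Quasi-optimality in `normU` follows from the equivalence `‖Θw‖² ≤ 3 ‖w‖²` and `‖w‖² ≤ 27 ‖Θw‖²`,
whose product 81 is the square of 9 (`existsUnique_minimal_residual`).

The upper bound `bilinB_le` is Cauchy–Schwarz: a skeleton duality may be evaluated with any
extension of the trace, hence is bounded by the infimum over the extensions.

The lower bound `normU_sq_le` is an inf-sup condition, proved in two steps. Write `E` for the dual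
norm of `b(u, ·)`. Conforming test functions in `H¹₀(Ω) × H(div, Ω)` do not see the traces. The
conforming solution of the adjoint problem `div τ = d⁻² u`, `τ + ∇z = σ` therefore isolates the
field variables, and its energy estimate gives `r ≤ 2.29 E` for the field norm `r` (`normField_le`).
For the traces, the minimum energy extension of `û` satisfies `div ∇w = d⁻² w` on each element,
because perturbing it by functions supported inside an element leaves the trace unchanged. Thus
`-∇w` is an admissible broken field that realises the trace norm of `û`, and this norm is at most `r
+ E`. The argument for `σ̂` is dual, with the function `-d² div ρ`.

Uniqueness is the inf-sup condition with `E = 0`. A solution is written down directly from the weak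
solution of the Poisson problem, so no inf-sup theorem for the adjoint operator is needed. -/

theorem IsTestFunction.memLp_inner_gradient (h : IsTestFunction D φ) (e : Eu n) :
    MemLp (fun x => (inner ℝ e (gradient φ x) : ℝ)) 2 (volume.restrict D) :=
  h.memLp_gradient.const_inner e

theorem IsTestFunction.memLp_smul (h : IsTestFunction D φ) (e : Eu n) :
    MemLp (fun x => φ x • e) 2 (volume.restrict D) :=
  ((h.smooth.continuous.smul continuous_const).memLp_of_hasCompactSupport
    (h.compact.smul_right (f' := fun _ => e))).restrict D

theorem L2_inner_eq {u w : L2 D} {f g : Eu n → ℝ} (hu : u =ᵐ[volume.restrict D] f)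
    (hw : w =ᵐ[volume.restrict D] g) : (inner ℝ u w : ℝ) = ∫ x in D, f x * g x := by
  rw [L2.inner_def]
  refine integral_congr_ae ?_
  filter_upwards [hu, hw] with x h1 h2
  rw [h1, h2]
  simp [mul_comm]

theorem L2v_inner_eq {u w : L2v D} {f g : Eu n → Eu n} (hu : u =ᵐ[volume.restrict D] f)
    (hw : w =ᵐ[volume.restrict D] g) :
    (inner ℝ u w : ℝ) = ∫ x in D, (inner ℝ (f x) (g x) : ℝ) := by
  rw [L2.inner_def]
  refine integral_congr_ae ?_
  filter_upwards [hu, hw] with x h1 h2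
  rw [h1, h2]

/-- A test function as an element of `L₂(D)`. -/
def testFun (h : IsTestFunction D φ) : L2 D := h.memLp.toLp φ

/-- The gradient of a test function as an element of `L₂(D)ⁿ`. -/
def testGrad (h : IsTestFunction D φ) : L2v D := h.memLp_gradient.toLp _

/-- The test field `φ e` as an element of `L₂(D)ⁿ`. -/
def testField (h : IsTestFunction D φ) (e : Eu n) : L2v D := (h.memLp_smul e).toLp _

/-- The divergence of the test field `φ e` as an element of `L₂(D)`. -/
def testDiv (h : IsTestFunction D φ) (e : Eu n) : L2 D := (h.memLp_inner_gradient e).toLp _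

theorem testFun_coeFn (h : IsTestFunction D φ) : testFun h =ᵐ[volume.restrict D] φ :=
  MemLp.coeFn_toLp _

theorem testGrad_coeFn (h : IsTestFunction D φ) :
    testGrad h =ᵐ[volume.restrict D] gradient φ :=
  MemLp.coeFn_toLp _

theorem testField_coeFn (h : IsTestFunction D φ) (e : Eu n) :
    testField h e =ᵐ[volume.restrict D] fun x => φ x • e :=
  MemLp.coeFn_toLp _

theorem testDiv_coeFn (h : IsTestFunction D φ) (e : Eu n) :
    testDiv h e =ᵐ[volume.restrict D] fun x => inner ℝ e (gradient φ x) :=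
  MemLp.coeFn_toLp _

theorem hasWeakDiv_iff {τ : L2v D} {w : L2 D} :
    HasWeakDiv D τ w ↔ ∀ (φ : Eu n → ℝ) (h : IsTestFunction D φ),
      (inner ℝ τ (testGrad h) : ℝ) + inner ℝ w (testFun h) = 0 := by
  refine forall₂_congr fun φ h => ?_
  rw [L2v_inner_eq (Filter.EventuallyEq.refl _ _) (testGrad_coeFn h),
    L2_inner_eq (Filter.EventuallyEq.refl _ _) (testFun_coeFn h), eq_neg_iff_add_eq_zero]

/-- Pairing the vector identity with an arbitrary `e` turns it into orthogonality to the pairs `(div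
(φ e), φ e)`. This exhibits `H1` as an intersection of kernels of continuous functionals, hence as a
closed subspace. -/
theorem hasWeakGrad_iff {v : L2 D} {g : L2v D} :
    HasWeakGrad D v g ↔ ∀ (φ : Eu n → ℝ) (h : IsTestFunction D φ) (e : Eu n),
      (inner ℝ v (testDiv h e) : ℝ) + inner ℝ g (testField h e) = 0 := by
  refine forall₂_congr fun φ h => ?_
  have i1 : Integrable (fun x => v x • gradient φ x) (volume.restrict D) :=
    memLp_one_iff_integrable.1 (h.memLp_gradient.smul (Lp.memLp v))
  have i2 : Integrable (fun x => φ x • g x) (volume.restrict D) :=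
    memLp_one_iff_integrable.1 ((Lp.memLp g).smul h.memLp)
  have key : ∀ e : Eu n, (inner ℝ v (testDiv h e) : ℝ) + inner ℝ g (testField h e)
      = inner ℝ e ((∫ x in D, v x • gradient φ x) + ∫ x in D, φ x • g x) := fun e => by
    rw [L2_inner_eq (Filter.EventuallyEq.refl _ _) (testDiv_coeFn h e),
      L2v_inner_eq (Filter.EventuallyEq.refl _ _) (testField_coeFn h e),
      inner_add_right, ← integral_inner i1, ← integral_inner i2]
    simp only [inner_smul_right, real_inner_comm]
  simp only [key, eq_neg_iff_add_eq_zero]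
  exact ⟨fun h0 e => by rw [h0, inner_zero_right], fun h0 => inner_self_eq_zero.1 (h0 _)⟩

/-- Both functions vanish outside `D`, so the integrals may be taken over the whole space, where
integration by parts has no boundary term and no regularity of `D` is required. -/
theorem IsTestFunction.integral_mul_inner_gradient (hφ : IsTestFunction D φ)
    (hψ : IsTestFunction D ψ) (e : Eu n) :
    (∫ x in D, φ x * (inner ℝ e (gradient ψ x) : ℝ))
      + ∫ x in D, (inner ℝ e (gradient φ x) : ℝ) * ψ x = 0 := by
  have hu : ∀ {χ : Eu n → ℝ}, IsTestFunction D χ → IsTestFunction univ χ :=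
    fun h => h.mono (subset_univ _)
  have hφ' := hu hφ
  have hψ' := hu hψ
  rw [setIntegral_eq_of_subset (subset_univ D) fun x hx => by rw [hφ.eq_zero hx, zero_mul],
    setIntegral_eq_of_subset (subset_univ D) fun x hx => by rw [hψ.eq_zero hx, mul_zero]]
  have e1 : ∀ (χ : Eu n → ℝ) (x : Eu n), (inner ℝ e (gradient χ x) : ℝ) = fderiv ℝ χ x e :=
    fun χ x => by rw [real_inner_comm, inner_gradient_left]
  have i1 := hφ'.memLp.integrable_mul (hψ'.memLp_inner_gradient e)
  have i2 := (hφ'.memLp_inner_gradient e).integrable_mul hψ'.memLp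
  have i3 := hφ'.memLp.integrable_mul hψ'.memLp
  simp only [e1, Measure.restrict_univ] at i1 i2 i3 ⊢
  rw [integral_mul_fderiv_eq_neg_fderiv_mul_of_integrable i2 i1 i3
    (fun x _ => (hφ.smooth.differentiable (by simp)).differentiableAt)
    (fun x _ => (hψ.smooth.differentiable (by simp)).differentiableAt), neg_add_cancel]

/-- A test function as an element of `H¹(D)`. -/
def testH1 (h : IsTestFunction D φ) : H1 D :=
  ⟨(testFun h, testGrad h), hasWeakGrad_iff.2 fun ψ hψ e => by
    rw [L2_inner_eq (testFun_coeFn h) (testDiv_coeFn hψ e),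
      L2v_inner_eq (testGrad_coeFn h) (testField_coeFn hψ e)]
    simpa only [inner_smul_right, real_inner_comm, mul_comm] using
      h.integral_mul_inner_gradient hψ e⟩

/-- The test field `φ e` as an element of `H(div, D)`. -/
def testHdiv (h : IsTestFunction D φ) (e : Eu n) : Hdiv D :=
  ⟨(testField h e, testDiv h e), hasWeakDiv_iff.2 fun ψ hψ => by
    rw [L2_inner_eq (testDiv_coeFn h e) (testFun_coeFn hψ),
      L2v_inner_eq (testField_coeFn h e) (testGrad_coeFn hψ)]
    simp only [real_inner_smul_left]
    exact h.integral_mul_inner_gradient hψ e⟩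

theorem isClosed_H1 : IsClosed (H1 D : Set (L2 D × L2v D)) := by
  have : (H1 D : Set (L2 D × L2v D)) = ⋂ (φ : Eu n → ℝ) (h : IsTestFunction D φ) (e : Eu n),
      {p | (inner ℝ p.1 (testDiv h e) : ℝ) + inner ℝ p.2 (testField h e) = 0} := by
    ext p
    simp only [mem_iInter]
    exact hasWeakGrad_iff
  rw [this]
  exact isClosed_iInter fun φ => isClosed_iInter fun h => isClosed_iInter fun e =>
    isClosed_eq (by fun_prop) continuous_const

theorem isClosed_Hdiv : IsClosed (Hdiv D : Set (L2v D × L2 D)) := by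
  have : (Hdiv D : Set (L2v D × L2 D)) = ⋂ (φ : Eu n → ℝ) (h : IsTestFunction D φ),
      {p | (inner ℝ p.1 (testGrad h) : ℝ) + inner ℝ p.2 (testFun h) = 0} := by
    ext p
    simp only [mem_iInter]
    exact hasWeakDiv_iff
  rw [this]
  exact isClosed_iInter fun φ => isClosed_iInter fun h =>
    isClosed_eq (by fun_prop) continuous_const

instance : CompleteSpace (H1 D) := isClosed_H1.completeSpace_coe

instance : CompleteSpace (Hdiv D) := isClosed_Hdiv.completeSpace_coe

/-! ### Lipschitz boundaries are null sets -/

/-- Locally the boundary lies on a graph over the hyperplane orthogonal to `ν`. The translates of a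
graph along `ν` are pairwise disjoint, and infinitely many bounded disjoint translates force measure
zero. -/
theorem HasLipschitzBoundary.volume_frontier (hD : IsOpen D) (h : HasLipschitzBoundary D) :
    volume (frontier D) = 0 := by
  refine measure_null_of_locally_null _ fun x hx => ?_
  obtain ⟨ν, hν, K, φ, hφ, r, hr, hgraph⟩ := h x hx
  have hc : Continuous fun y : Eu n => φ (y - (inner ℝ ν y : ℝ) • ν) :=
    hφ.continuous.comp (by fun_prop)
  have hi : Continuous fun y : Eu n => (inner ℝ ν y : ℝ) := by fun_prop
  refine ⟨frontier D ∩ Metric.ball x r,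
    Filter.inter_mem self_mem_nhdsWithin (mem_nhdsWithin_of_mem_nhds (Metric.ball_mem_nhds x hr)), ?_⟩
  -- A boundary point is not below the graph, since `D` is open, nor strictly above it, since a
  -- whole neighbourhood would then miss `D`.
  have hsub : frontier D ∩ Metric.ball x r ⊆
      {y | (inner ℝ ν y : ℝ) = φ (y - (inner ℝ ν y : ℝ) • ν)} := by
    rintro y ⟨hy, hyr⟩
    have hyD : y ∉ D := fun hyD => by
      rw [hD.frontier_eq] at hy
      exact hy.2 hyD
    refine le_antisymm ?_ (not_lt.1 fun hlt => hyD ((hgraph y hyr).2 hlt))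
    by_contra! hlt
    have hU : IsOpen (Metric.ball x r ∩
        {z | φ (z - (inner ℝ ν z : ℝ) • ν) < (inner ℝ ν z : ℝ)}) :=
      Metric.isOpen_ball.inter (isOpen_lt hc hi)
    obtain ⟨z, ⟨hz1, hz2⟩, hz3⟩ :=
      mem_closure_iff.1 (frontier_subset_closure hy) _ hU ⟨hyr, hlt⟩
    exact lt_asymm hz2 ((hgraph z hz1).1 hz3)
  refine measure_mono_null hsub ?_
  refine Measure.addHaar_eq_zero_of_disjoint_translates volume
    (fun m : ℕ => (2⁻¹ : ℝ) ^ m • ν) ?_ ?_ (isClosed_eq hi hc).measurableSet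
  · refine (Metric.isBounded_closedBall (x := (0 : Eu n)) (r := 1)).subset ?_
    rintro _ ⟨m, rfl⟩
    simp only [mem_closedBall_zero_iff, norm_smul, hν, mul_one]
    rw [norm_pow]
    exact pow_le_one₀ (norm_nonneg _) (by norm_num)
  · intro m k hmk
    have key : ∀ (c : ℝ) (y : Eu n), y ∈ ({c • ν} : Set (Eu n)) +
        {y | (inner ℝ ν y : ℝ) = φ (y - (inner ℝ ν y : ℝ) • ν)} →
        (inner ℝ ν y : ℝ) = φ (y - (inner ℝ ν y : ℝ) • ν) + c := by
      rintro c y hy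
      obtain ⟨z, hz, rfl⟩ := by simpa only [singleton_add, mem_image] using! hy
      have hν2 : (inner ℝ ν ν : ℝ) = 1 := by rw [real_inner_self_eq_norm_sq, hν, one_pow]
      have hin : (inner ℝ ν (c • ν + z) : ℝ) = inner ℝ ν z + c := by
        rw [inner_add_right, inner_smul_right, hν2]; ring
      have hp : c • ν + z - (inner ℝ ν z + c : ℝ) • ν = z - (inner ℝ ν z : ℝ) • ν := by module
      rw [hin, hp, ← hz]
    refine disjoint_left.2 fun y hy1 hy2 => hmk ?_
    have h1 := key _ y hy1
    have h2 := key _ y hy2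
    exact (pow_right_strictAnti₀ (by norm_num : (0 : ℝ) < 2⁻¹) (by norm_num)).injective
      (by linarith)

/-! ### Restriction to the elements of a mesh -/

variable {ι : Type*} {T : ι → Set (Eu n)}

/-- The mesh only covers up to closures; what is missed lies on the boundaries of the elements,
which are null sets. -/
theorem IsMesh.ae_eq [Finite ι] (hT : IsMesh Ω T) : Ω =ᵐ[volume] ⋃ i, T i := by
  refine Filter.EventuallyLE.antisymm ?_ (iUnion_subset hT.subset).eventuallyLE
  have h0 : volume (⋃ i, frontier (T i)) = 0 :=
    measure_iUnion_null fun i => (hT.lipschitz i).volume_frontier (hT.isOpen i)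
  refine (ae_le_set.2 (measure_mono_null ?_ h0))
  rintro x ⟨hx, hx'⟩
  have hc := subset_closure hx
  rw [hT.cover] at hc
  obtain ⟨i, hi⟩ := mem_iUnion.1 hc
  refine mem_iUnion.2 ⟨i, ?_⟩
  rw [(hT.isOpen i).frontier_eq]
  exact ⟨hi, fun h => hx' (mem_iUnion.2 ⟨i, h⟩)⟩

/-- This reassembles elementwise pairings: on conforming arguments every broken sum becomes an
`L₂(Ω)` product. -/
theorem IsMesh.sum_inner_restrictLp [Fintype ι] (hT : IsMesh Ω T) {F : Type*}
    [NormedAddCommGroup F] [InnerProductSpace ℝ F] (u w : Lp F 2 (volume.restrict Ω)) :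
    ∑ i, (inner ℝ (restrictLp (hT.subset i) u) (restrictLp (hT.subset i) w) : ℝ)
      = inner ℝ u w := by
  have hint : IntegrableOn (fun x => (inner ℝ (u x) (w x) : ℝ)) Ω volume := L2.integrable_inner u w
  rw [L2.inner_def, setIntegral_congr_set hT.ae_eq,
    integral_iUnion_fintype (fun i => (hT.isOpen i).measurableSet) hT.disjoint
      (fun i => hint.mono_set (hT.subset i))]
  refine Finset.sum_congr rfl fun i _ => ?_
  rw [L2.inner_def]
  refine integral_congr_ae ?_
  filter_upwards [restrictLp_coeFn (hT.subset i) u, restrictLp_coeFn (hT.subset i) w] with x h1 h2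
  rw [h1, h2]

theorem IsMesh.sum_norm_restrictLp [Fintype ι] (hT : IsMesh Ω T) {F : Type*}
    [NormedAddCommGroup F] [InnerProductSpace ℝ F] (u : Lp F 2 (volume.restrict Ω)) :
    ∑ i, ‖restrictLp (hT.subset i) u‖ ^ 2 = ‖u‖ ^ 2 := by
  simp only [← real_inner_self_eq_norm_sq]
  exact hT.sum_inner_restrictLp u u

theorem continuous_restrictLp {F : Type*} [NormedAddCommGroup F] [NormedSpace ℝ F] (h : D ⊆ Ω) :
    Continuous (restrictLp (F := F) h) := by
  refine AddMonoidHomClass.continuous_of_bound (restrictLp (F := F) h) 1 fun v => ?_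
  rw [one_mul, Lp.norm_def, Lp.norm_def]
  refine ENNReal.toReal_mono (Lp.eLpNorm_ne_top v) ?_
  rw [eLpNorm_congr_ae (restrictLp_coeFn h v)]
  exact eLpNorm_mono_measure _ (Measure.restrict_mono_set volume h)

theorem restrictLp_toLp {F : Type*} [NormedAddCommGroup F] [NormedSpace ℝ F] (h : D ⊆ Ω)
    {f : Eu n → F} (hf : MemLp f 2 (volume.restrict Ω)) (hf' : MemLp f 2 (volume.restrict D)) :
    restrictLp h (hf.toLp f) = hf'.toLp f :=
  MemLp.toLp_congr ((Lp.memLp _).mono_measure (Measure.restrict_mono_set volume h)) hf'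
    (ae_mono (Measure.restrict_mono_set volume h) hf.coeFn_toLp)

theorem inner_restrictLp_toLp {F : Type*} [NormedAddCommGroup F] [InnerProductSpace ℝ F]
    (h : D ⊆ Ω) (u : Lp F 2 (volume.restrict Ω)) {f : Eu n → F}
    (hf : MemLp f 2 (volume.restrict Ω)) (hf' : MemLp f 2 (volume.restrict D))
    (h0 : ∀ x, x ∉ D → f x = 0) :
    (inner ℝ (restrictLp h u) (hf'.toLp f) : ℝ) = inner ℝ u (hf.toLp f) := by
  rw [L2.inner_def, L2.inner_def]
  have e1 : ∫ x in D, (inner ℝ ((restrictLp h u) x) ((hf'.toLp f) x) : ℝ)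
      = ∫ x in D, (inner ℝ (u x) (f x) : ℝ) := by
    refine integral_congr_ae ?_
    filter_upwards [restrictLp_coeFn h u, hf'.coeFn_toLp] with x h1 h2
    rw [h1, h2]
  have e2 : ∫ x in Ω, (inner ℝ (u x) ((hf.toLp f) x) : ℝ)
      = ∫ x in Ω, (inner ℝ (u x) (f x) : ℝ) := by
    refine integral_congr_ae ?_
    filter_upwards [hf.coeFn_toLp] with x h1
    rw [h1]
  rw [e1, e2]
  exact setIntegral_eq_of_subset h fun x hx => by rw [h0 x hx, inner_zero_right]

theorem restrictLp_toLp_eq_zero {F : Type*} [NormedAddCommGroup F] [NormedSpace ℝ F] (h : D ⊆ Ω)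
    (hD : MeasurableSet D)
    {f : Eu n → F} (hf : MemLp f 2 (volume.restrict Ω)) (h0 : ∀ x ∈ D, f x = 0) :
    restrictLp h (hf.toLp f) = 0 := by
  rw [restrictLp_toLp h hf (hf.mono_measure (Measure.restrict_mono_set volume h)),
    Lp.eq_zero_iff_ae_eq_zero]
  refine (MemLp.coeFn_toLp _).trans ?_
  filter_upwards [ae_restrict_mem hD] with x hx using h0 x hx

/-- Extension by zero of test functions and their derivatives is dual to restriction. -/
theorem inner_restrictLp_testFun (h : D ⊆ Ω) (hφ : IsTestFunction D φ) (u : L2 Ω) :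
    (inner ℝ (restrictLp h u) (testFun hφ) : ℝ) = inner ℝ u (testFun (hφ.mono h)) :=
  inner_restrictLp_toLp h u _ _ fun _ hx => hφ.eq_zero hx

theorem inner_restrictLp_testGrad (h : D ⊆ Ω) (hφ : IsTestFunction D φ) (u : L2v Ω) :
    (inner ℝ (restrictLp h u) (testGrad hφ) : ℝ) = inner ℝ u (testGrad (hφ.mono h)) :=
  inner_restrictLp_toLp h u _ _ fun _ hx => hφ.gradient_eq_zero hx

theorem inner_restrictLp_testField (h : D ⊆ Ω) (hφ : IsTestFunction D φ) (e : Eu n) (u : L2v Ω) :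
    (inner ℝ (restrictLp h u) (testField hφ e) : ℝ) = inner ℝ u (testField (hφ.mono h) e) :=
  inner_restrictLp_toLp h u _ _ fun _ hx => by rw [hφ.eq_zero hx, zero_smul]

theorem inner_restrictLp_testDiv (h : D ⊆ Ω) (hφ : IsTestFunction D φ) (e : Eu n) (u : L2 Ω) :
    (inner ℝ (restrictLp h u) (testDiv hφ e) : ℝ) = inner ℝ u (testDiv (hφ.mono h) e) :=
  inner_restrictLp_toLp h u _ _ fun _ hx => by rw [hφ.gradient_eq_zero hx, inner_zero_right]

theorem restrictH1_testH1 (h : D ⊆ Ω) (hφ : IsTestFunction D φ) :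
    restrictH1 h (testH1 (hφ.mono h)) = testH1 hφ :=
  Subtype.ext (Prod.ext
    (restrictLp_toLp h (hφ.mono h).memLp hφ.memLp)
    (restrictLp_toLp h (hφ.mono h).memLp_gradient hφ.memLp_gradient))

theorem restrictHdiv_testHdiv (h : D ⊆ Ω) (hφ : IsTestFunction D φ) (e : Eu n) :
    restrictHdiv h (testHdiv (hφ.mono h) e) = testHdiv hφ e :=
  Subtype.ext (Prod.ext
    (restrictLp_toLp h ((hφ.mono h).memLp_smul e) (hφ.memLp_smul e))
    (restrictLp_toLp h ((hφ.mono h).memLp_inner_gradient e) (hφ.memLp_inner_gradient e)))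

theorem restrictH1_testH1_eq_zero {D' : Set (Eu n)} (h : D ⊆ Ω) (h' : D' ⊆ Ω)
    (hD' : MeasurableSet D') (hdisj : Disjoint D' D) (hφ : IsTestFunction D φ) :
    restrictH1 h' (testH1 (hφ.mono h)) = 0 :=
  Subtype.ext (Prod.ext
    (restrictLp_toLp_eq_zero h' hD' (hφ.mono h).memLp fun _ hx => hφ.eq_zero (disjoint_left.1 hdisj hx))
    (restrictLp_toLp_eq_zero h' hD' (hφ.mono h).memLp_gradient fun _ hx => hφ.gradient_eq_zero (disjoint_left.1 hdisj hx)))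

theorem restrictHdiv_testHdiv_eq_zero {D' : Set (Eu n)} (h : D ⊆ Ω) (h' : D' ⊆ Ω)
    (hD' : MeasurableSet D') (hdisj : Disjoint D' D) (hφ : IsTestFunction D φ) (e : Eu n) :
    restrictHdiv h' (testHdiv (hφ.mono h) e) = 0 :=
  Subtype.ext (Prod.ext
    (restrictLp_toLp_eq_zero h' hD' ((hφ.mono h).memLp_smul e) fun _ hx => by
      rw [hφ.eq_zero (disjoint_left.1 hdisj hx), zero_smul])
    (restrictLp_toLp_eq_zero h' hD' ((hφ.mono h).memLp_inner_gradient e) fun _ hx => by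
      rw [hφ.gradient_eq_zero (disjoint_left.1 hdisj hx), inner_zero_right]))

end

section

/-! ### Riesz representation -/

/-- The spaces at hand carry the maximum norm of a product, which is not Hilbertian. A map `J`
bounded below identifies `V` with a closed subspace of `H`, where the Riesz theorem applies; the
inner product of interest is the one pulled back by `J`. -/
theorem exists_riesz {V H : Type*} [NormedAddCommGroup V] [NormedSpace ℝ V] [CompleteSpace V]
    [NormedAddCommGroup H] [InnerProductSpace ℝ H] [CompleteSpace H] (J : V →L[ℝ] H)
    {K : NNReal} (hJ : ∀ v, ‖v‖ ≤ K * ‖J v‖) (l : V →L[ℝ] ℝ) :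
    ∃ θ : V, ∀ v, (inner ℝ (J θ) (J v) : ℝ) = l v := by
  have ha : AntilipschitzWith K J := AddMonoidHomClass.antilipschitz_of_bound J hJ
  have hcl : IsClosed (range J) := ha.isClosed_range J.uniformContinuous
  let e := J.equivRange ha.injective hcl
  have : CompleteSpace J.range := IsClosed.completeSpace_coe (hs := hcl)
  obtain ⟨y, hy⟩ := (InnerProductSpace.toDual ℝ J.range).surjective
    (l.comp (e.symm : J.range →L[ℝ] V))
  have he : ∀ v, ((e v : J.range) : H) = J v := fun v => rfl
  refine ⟨e.symm y, fun v => ?_⟩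
  have h1 := congrArg (fun q => q (e v)) hy
  simp only [InnerProductSpace.toDual_apply_apply, ContinuousLinearMap.comp_apply,
    ContinuousLinearEquiv.coe_coe, ContinuousLinearEquiv.symm_apply_apply] at h1
  rw [← h1, ← he, ← he, ContinuousLinearEquiv.apply_symm_apply]
  rfl

/-- The product of two Hilbert spaces with rescaled factors. -/
def scaleProd (X Y : Type*) [NormedAddCommGroup X] [InnerProductSpace ℝ X]
    [NormedAddCommGroup Y] [InnerProductSpace ℝ Y] (α β : ℝ) : X × Y →L[ℝ] WithLp 2 (X × Y) :=
  (WithLp.prodContinuousLinearEquiv 2 ℝ X Y).symm.toContinuousLinearMap.comp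
    ((α • ContinuousLinearMap.id ℝ X).prodMap (β • ContinuousLinearMap.id ℝ Y))

section

variable {X Y : Type*} [NormedAddCommGroup X] [InnerProductSpace ℝ X]
  [NormedAddCommGroup Y] [InnerProductSpace ℝ Y]

theorem inner_scaleProd (α β : ℝ) (p q : X × Y) :
    (inner ℝ (scaleProd X Y α β p) (scaleProd X Y α β q) : ℝ)
      = α ^ 2 * inner ℝ p.1 q.1 + β ^ 2 * inner ℝ p.2 q.2 := by
  simp only [scaleProd, WithLp.prod_inner_apply]
  simp [inner_smul_left, inner_smul_right]
  ring

theorem exists_norm_le_scaleProd {α β : ℝ} (hα : 0 < α) (hβ : 0 < β) :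
    ∃ K : NNReal, ∀ p : X × Y, ‖p‖ ≤ K * ‖scaleProd X Y α β p‖ := by
  refine ⟨⟨α⁻¹ + β⁻¹, by positivity⟩, fun p => ?_⟩
  have h2 : ‖scaleProd X Y α β p‖ ^ 2 = (α * ‖p.1‖) ^ 2 + (β * ‖p.2‖) ^ 2 := by
    rw [← real_inner_self_eq_norm_sq, inner_scaleProd, real_inner_self_eq_norm_sq,
      real_inner_self_eq_norm_sq]
    ring
  have h3 : α * ‖p.1‖ ≤ ‖scaleProd X Y α β p‖ := by
    refine abs_le_of_sq_le_sq' ?_ (norm_nonneg _) |>.2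
    rw [h2]; nlinarith [sq_nonneg (β * ‖p.2‖)]
  have h4 : β * ‖p.2‖ ≤ ‖scaleProd X Y α β p‖ := by
    refine abs_le_of_sq_le_sq' ?_ (norm_nonneg _) |>.2
    rw [h2]; nlinarith [sq_nonneg (α * ‖p.1‖)]
  have h5 : ‖p.1‖ ≤ α⁻¹ * ‖scaleProd X Y α β p‖ := by
    rw [← div_eq_inv_mul, le_div_iff₀ hα, mul_comm]; exact h3
  have h6 : ‖p.2‖ ≤ β⁻¹ * ‖scaleProd X Y α β p‖ := by
    rw [← div_eq_inv_mul, le_div_iff₀ hβ, mul_comm]; exact h4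
  have h7 : 0 ≤ α⁻¹ * ‖scaleProd X Y α β p‖ := by positivity
  have h8 : 0 ≤ β⁻¹ * ‖scaleProd X Y α β p‖ := by positivity
  rw [Prod.norm_def]
  change max ‖p.1‖ ‖p.2‖ ≤ (α⁻¹ + β⁻¹) * _
  rw [add_mul]
  exact max_le (by linarith) (by linarith)

theorem exists_riesz_prod [CompleteSpace X] [CompleteSpace Y] {V : Type*} [NormedAddCommGroup V]
    [NormedSpace ℝ V] [CompleteSpace V] (I : V →L[ℝ] X × Y) (hI : ∀ v, ‖I v‖ = ‖v‖) {a b : ℝ}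
    (ha : 0 < a) (hb : 0 < b) (l : V →L[ℝ] ℝ) :
    ∃ θ : V, ∀ v, a * (inner ℝ (I θ).1 (I v).1 : ℝ) + b * inner ℝ (I θ).2 (I v).2 = l v := by
  obtain ⟨K, hK⟩ := exists_norm_le_scaleProd (X := X) (Y := Y) (Real.sqrt_pos.2 ha)
    (Real.sqrt_pos.2 hb)
  obtain ⟨θ, hθ⟩ := exists_riesz ((scaleProd X Y (√a) (√b)).comp I)
    (K := K) (fun v => by rw [← hI v]; exact hK _) l
  refine ⟨θ, fun v => ?_⟩
  rw [← hθ v, ContinuousLinearMap.comp_apply, ContinuousLinearMap.comp_apply, inner_scaleProd,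
    Real.sq_sqrt ha.le, Real.sq_sqrt hb.le]

/-- Subtracting from `p` its weighted projection onto the kernel gives the element of least energy
in the coset of `p`; the conclusion is its Euler–Lagrange equation. Only closedness of the kernel
matters, so `M` needs no topology. -/
theorem exists_minimal_of_isClosed_ker [CompleteSpace X] [CompleteSpace Y]
    (S : Submodule ℝ (X × Y)) [CompleteSpace S] {M : Type*} [AddCommGroup M] [Module ℝ M]
    (f : S →ₗ[ℝ] M) (hf : IsClosed (LinearMap.ker f : Set S)) {a b : ℝ} (ha : 0 < a)
    (hb : 0 < b) (p : S) : ∃ q, f q = f p ∧ ∀ t, f t = 0 →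
      a * (inner ℝ q.1.1 t.1.1 : ℝ) + b * inner ℝ q.1.2 t.1.2 = 0 := by
  have : CompleteSpace (LinearMap.ker f) := hf.completeSpace_coe
  let I : LinearMap.ker f →L[ℝ] X × Y := S.subtypeL.comp (LinearMap.ker f).subtypeL
  obtain ⟨z, hz⟩ := exists_riesz_prod (V := LinearMap.ker f) I (fun v => rfl) ha hb
    (a • (innerSL ℝ p.1.1).comp ((ContinuousLinearMap.fst ℝ X Y).comp I)
      + b • (innerSL ℝ p.1.2).comp ((ContinuousLinearMap.snd ℝ X Y).comp I))
  refine ⟨p - z.1, by rw [map_sub, LinearMap.mem_ker.1 z.2, sub_zero], fun t ht => ?_⟩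
  have h : a * (inner ℝ z.1.1.1 t.1.1 : ℝ) + b * inner ℝ z.1.1.2 t.1.2
      = a * inner ℝ p.1.1 t.1.1 + b * inner ℝ p.1.2 t.1.2 := hz ⟨t, ht⟩
  simp only [Submodule.coe_sub, Prod.fst_sub, Prod.snd_sub, inner_sub_left]
  linarith

end

variable {n : ℕ} {D Ω : Set (Eu n)} {φ : Eu n → ℝ}

/-! ### The Poisson problem -/

/-- For test functions this is the definition of the weak divergence. The functional `traceDivLoc Ω
τ` is continuous, so the identity passes to the closure. -/
theorem inner_add_inner_eq_zero_of_mem_H10 {w : H1 Ω} (hw : w ∈ H10 Ω) (τ : Hdiv Ω) :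
    (inner ℝ w.1.1 τ.1.2 : ℝ) + inner ℝ w.1.2 τ.1.1 = 0 := by
  change traceGradLoc Ω w τ = 0
  have hle : H10 Ω ≤ LinearMap.ker ((traceDivLoc Ω τ : H1 Ω →L[ℝ] ℝ) : H1 Ω →ₗ[ℝ] ℝ) := by
    refine Submodule.topologicalClosure_minimal _ (Submodule.span_le.2 ?_)
      (traceDivLoc Ω τ).isClosed_ker
    rintro v ⟨φ, hφ, h1, h2⟩
    have e1 : v.1.1 = testFun hφ := Lp.ext (h1.trans (testFun_coeFn hφ).symm)
    have e2 : v.1.2 = testGrad hφ := Lp.ext (h2.trans (testGrad_coeFn hφ).symm)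
    change (inner ℝ τ.1.1 v.1.2 : ℝ) + inner ℝ τ.1.2 v.1.1 = 0
    rw [e1, e2]
    exact hasWeakDiv_iff.1 τ.2 φ hφ
  have h0 : (inner ℝ τ.1.1 w.1.2 : ℝ) + inner ℝ τ.1.2 w.1.1 = 0 := hle hw
  change (inner ℝ w.1.1 τ.1.2 : ℝ) + inner ℝ w.1.2 τ.1.1 = 0
  rw [← h0, add_comm, real_inner_comm w.1.2, real_inner_comm w.1.1]

theorem testH1_mem_H10 (h : IsTestFunction D φ) : testH1 h ∈ H10 D :=
  Submodule.le_topologicalClosure _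
    (Submodule.subset_span ⟨φ, h, testFun_coeFn h, testGrad_coeFn h⟩)

theorem exists_poisson {d : ℝ} (hd : 0 < d) (hPF : PoincareFriedrichs Ω d) (a : L2 Ω)
    (c : L2v Ω) : ∃ z ∈ H10 Ω, ∀ w ∈ H10 Ω,
      (inner ℝ z.1.2 w.1.2 : ℝ) = inner ℝ c w.1.2 + inner ℝ a w.1.1 := by
  have : CompleteSpace (H10 Ω) :=
    (Submodule.isClosed_topologicalClosure _).completeSpace_coe
  let I : H10 Ω →L[ℝ] L2 Ω × L2v Ω := (H1 Ω).subtypeL.comp (H10 Ω).subtypeL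
  obtain ⟨z, hz⟩ := exists_riesz ((ContinuousLinearMap.snd ℝ _ _).comp I)
    -- By Poincaré–Friedrichs the gradient alone bounds the maximum norm of the pair, with constant
    -- `max d 1 ≤ d + 1`.
    (K := ⟨d + 1, by positivity⟩) (fun v => by
      have h1 := hPF v.1 v.2
      have h2 : 0 ≤ ‖v.1.1.2‖ := norm_nonneg _
      have h3 : 0 ≤ d * ‖v.1.1.2‖ := by positivity
      change max ‖v.1.1.1‖ ‖v.1.1.2‖ ≤ (d + 1) * ‖v.1.1.2‖
      exact max_le (by linarith) (by linarith))
    ((innerSL ℝ c).comp ((ContinuousLinearMap.snd ℝ _ _).comp I)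
      + (innerSL ℝ a).comp ((ContinuousLinearMap.fst ℝ _ _).comp I))
  exact ⟨z.1, z.2, fun w hw => hz ⟨w, hw⟩⟩

/-- The variational equation tested with test functions says exactly that `c - ∇z` has weak
divergence `a`. It is used twice: for the adjoint problem (`c = σ`, `a = d⁻² u`) and for the exact
solution (`c = 0`, `a = f`). -/
theorem exists_poisson_hdiv {d : ℝ} (hd : 0 < d) (hPF : PoincareFriedrichs Ω d) (a : L2 Ω)
    (c : L2v Ω) : ∃ z ∈ H10 Ω, ∃ τ : Hdiv Ω, τ.1.1 = c - z.1.2 ∧ τ.1.2 = a ∧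
      (inner ℝ z.1.2 z.1.2 : ℝ) = inner ℝ c z.1.2 + inner ℝ a z.1.1 := by
  obtain ⟨z, hz, h⟩ := exists_poisson hd hPF a c
  refine ⟨z, hz, ⟨(c - z.1.2, a), hasWeakDiv_iff.2 fun φ hφ => ?_⟩, rfl, rfl, h z hz⟩
  have := h _ (testH1_mem_H10 hφ)
  change (inner ℝ (c - z.1.2) (testGrad hφ) : ℝ) + inner ℝ a (testFun hφ) = 0
  change (inner ℝ z.1.2 (testGrad hφ) : ℝ) = inner ℝ c (testGrad hφ) + inner ℝ a (testFun hφ)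
    at this
  rw [inner_sub_left, this]
  ring

/-! ### Skeleton traces -/

variable {ι : Type*} [Fintype ι] {T : ι → Set (Eu n)} (hT : IsMesh Ω T)

theorem skelGrad_apply (w : H1 Ω) (τ : BrokenHdiv T) :
    skelGrad hT w τ = ∑ i, ((inner ℝ (restrictLp (hT.subset i) w.1.1) (τ i).1.2 : ℝ)
      + inner ℝ (restrictLp (hT.subset i) w.1.2) (τ i).1.1) := by
  simp only [skelGrad, traceGrad, LinearMap.comp_apply, LinearMap.coe_mk, AddHom.coe_mk,
    _root_.sum_apply, ContinuousLinearMap.comp_apply]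
  rfl

theorem skelDiv_apply (ρ : Hdiv Ω) (v : BrokenH1 T) :
    skelDiv hT ρ v = ∑ i, ((inner ℝ (restrictLp (hT.subset i) ρ.1.1) (v i).1.2 : ℝ)
      + inner ℝ (restrictLp (hT.subset i) ρ.1.2) (v i).1.1) := by
  simp only [skelDiv, traceDiv, LinearMap.comp_apply, LinearMap.coe_mk, AddHom.coe_mk,
    _root_.sum_apply, ContinuousLinearMap.comp_apply]
  rfl

theorem isClosed_ker_skelGrad :
    IsClosed (LinearMap.ker (skelGrad hT) : Set (H1 Ω)) := by
  have : (LinearMap.ker (skelGrad hT) : Set (H1 Ω)) = ⋂ τ : BrokenHdiv T,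
      {w | ∑ i, ((inner ℝ (restrictLp (hT.subset i) w.1.1) (τ i).1.2 : ℝ)
        + inner ℝ (restrictLp (hT.subset i) w.1.2) (τ i).1.1) = 0} := by
    ext w
    refine ⟨fun h => mem_iInter.2 fun τ => ?_, fun h => LinearMap.mem_ker.2
      (ContinuousLinearMap.ext fun τ => (skelGrad_apply hT _ _).trans (mem_iInter.1 h τ))⟩
    refine (skelGrad_apply hT _ _).symm.trans ?_
    rw [LinearMap.mem_ker.1 h]
    rfl
  rw [this]
  refine isClosed_iInter fun τ => isClosed_eq (continuous_finsetSum _ fun i _ => ?_)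
    continuous_const
  exact (((continuous_restrictLp (hT.subset i)).comp
    (continuous_fst.comp continuous_subtype_val)).inner continuous_const).add
    (((continuous_restrictLp (hT.subset i)).comp
    (continuous_snd.comp continuous_subtype_val)).inner continuous_const)

theorem isClosed_ker_skelDiv :
    IsClosed (LinearMap.ker (skelDiv hT) : Set (Hdiv Ω)) := by
  have : (LinearMap.ker (skelDiv hT) : Set (Hdiv Ω)) = ⋂ v : BrokenH1 T,
      {ρ | ∑ i, ((inner ℝ (restrictLp (hT.subset i) ρ.1.1) (v i).1.2 : ℝ)
        + inner ℝ (restrictLp (hT.subset i) ρ.1.2) (v i).1.1) = 0} := by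
    ext w
    refine ⟨fun h => mem_iInter.2 fun v => ?_, fun h => LinearMap.mem_ker.2
      (ContinuousLinearMap.ext fun v => (skelDiv_apply hT _ _).trans (mem_iInter.1 h v))⟩
    refine (skelDiv_apply hT _ _).symm.trans ?_
    rw [LinearMap.mem_ker.1 h]
    rfl
  rw [this]
  refine isClosed_iInter fun τ => isClosed_eq (continuous_finsetSum _ fun i _ => ?_)
    continuous_const
  exact (((continuous_restrictLp (hT.subset i)).comp
    (continuous_fst.comp continuous_subtype_val)).inner continuous_const).add
    (((continuous_restrictLp (hT.subset i)).comp
    (continuous_snd.comp continuous_subtype_val)).inner continuous_const)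

end

/-! ### Interior perturbations and minimum energy extensions -/

section

variable {n : ℕ} {D Ω : Set (Eu n)} {ι : Type*} [Fintype ι] {T : ι → Set (Eu n)}
  (hT : IsMesh Ω T)

theorem inner_add_inner_comm {X Y : Type*} [NormedAddCommGroup X] [InnerProductSpace ℝ X]
    [NormedAddCommGroup Y] [InnerProductSpace ℝ Y] (x x' : X) (y y' : Y) :
    (inner ℝ x x' : ℝ) + inner ℝ y y' = inner ℝ y' y + inner ℝ x' x := by
  rw [real_inner_comm x x', real_inner_comm y y', add_comm]

theorem traceGradLoc_testH1 (h : IsTestFunction D φ) (τ : Hdiv D) :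
    traceGradLoc D (testH1 h) τ = 0 :=
  (inner_add_inner_comm (testFun h) τ.1.2 (testGrad h) τ.1.1).trans (hasWeakDiv_iff.1 τ.2 φ h)

theorem traceDivLoc_testHdiv (h : IsTestFunction D φ) (e : Eu n) (v : H1 D) :
    traceDivLoc D (testHdiv h e) v = 0 :=
  (inner_add_inner_comm (testField h e) v.1.2 (testDiv h e) v.1.1).trans
    (hasWeakGrad_iff.1 v.2 φ h e)

theorem traceGradLoc_zero (τ : Hdiv D) : traceGradLoc D 0 τ = 0 := by
  have h : (inner ℝ (0 : L2 D) τ.1.2 : ℝ) + inner ℝ (0 : L2v D) τ.1.1 = 0 := by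
    rw [inner_zero_left, inner_zero_left, add_zero]
  exact h

theorem traceDivLoc_zero (v : H1 D) : traceDivLoc D 0 v = 0 := by
  have h : (inner ℝ (0 : L2v D) v.1.2 : ℝ) + inner ℝ (0 : L2 D) v.1.1 = 0 := by
    rw [inner_zero_left, inner_zero_left, add_zero]
  exact h

/-- On its own element integration by parts kills the trace; on the others the function is zero.
Such functions are the admissible variations of an extension with fixed trace. -/
theorem skelGrad_testH1 {i : ι} (h : IsTestFunction (T i) φ) :
    skelGrad hT (testH1 (h.mono (hT.subset i))) = 0 := by
  refine ContinuousLinearMap.ext fun τ => (skelGrad_apply hT _ τ).trans ?_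
  refine Finset.sum_eq_zero fun j _ => ?_
  by_cases hj : j = i
  · subst hj
    exact (congrArg (fun w => traceGradLoc (T j) w (τ j)) (restrictH1_testH1 (hT.subset j) h)).trans
      (traceGradLoc_testH1 h _)
  · exact (congrArg (fun w => traceGradLoc (T j) w (τ j)) (restrictH1_testH1_eq_zero (hT.subset i)
      (hT.subset j) (hT.isOpen j).measurableSet (hT.disjoint hj) h)).trans (traceGradLoc_zero _)

theorem skelDiv_testHdiv {i : ι} (h : IsTestFunction (T i) φ) (e : Eu n) :
    skelDiv hT (testHdiv (h.mono (hT.subset i)) e) = 0 := by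
  refine ContinuousLinearMap.ext fun v => (skelDiv_apply hT _ v).trans ?_
  refine Finset.sum_eq_zero fun j _ => ?_
  by_cases hj : j = i
  · subst hj
    exact (congrArg (fun ρ => traceDivLoc (T j) ρ (v j))
      (restrictHdiv_testHdiv (hT.subset j) h e)).trans (traceDivLoc_testHdiv h e _)
  · exact (congrArg (fun ρ => traceDivLoc (T j) ρ (v j)) (restrictHdiv_testHdiv_eq_zero
      (hT.subset i) (hT.subset j) (hT.isOpen j).measurableSet (hT.disjoint hj) h e)).trans
      (traceDivLoc_zero _)

/-- The minimum energy extension of a trace solves `div ∇w = d⁻² w` on each element. -/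
theorem exists_minimal_extension_grad {d : ℝ} (hd : 0 < d) (w₀ : TrGrad hT) :
    ∃ w : H1 Ω, skelGrad hT w = w₀ ∧ ∀ i, HasWeakDiv (T i) (restrictLp (hT.subset i) w.1.2)
      (restrictLp (hT.subset i) ((d ^ 2)⁻¹ • w.1.1)) := by
  obtain ⟨w, -, hw⟩ := w₀.2
  have hmin : ∃ q, skelGrad hT q = skelGrad hT w ∧ ∀ t, skelGrad hT t = 0 →
      (d ^ 2)⁻¹ * (inner ℝ q.1.1 t.1.1 : ℝ) + 1 * inner ℝ q.1.2 t.1.2 = 0 :=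
    exists_minimal_of_isClosed_ker (H1 Ω) _ (isClosed_ker_skelGrad hT) (by positivity) one_pos w
  obtain ⟨q, hq, h⟩ := hmin
  refine ⟨q, hq.trans hw, fun i => hasWeakDiv_iff.2 fun φ hφ => ?_⟩
  have h1 : (d ^ 2)⁻¹ * (inner ℝ q.1.1 (testFun (hφ.mono (hT.subset i))) : ℝ)
      + 1 * inner ℝ q.1.2 (testGrad (hφ.mono (hT.subset i))) = 0 :=
    h (testH1 (hφ.mono (hT.subset i))) (skelGrad_testH1 hT hφ)
  rw [inner_restrictLp_testGrad, inner_restrictLp_testFun, real_inner_smul_left]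
  linarith

/-- The minimum energy extension of a normal trace solves `d² ∇ div ρ = ρ` on each element. -/
theorem exists_minimal_extension_div {d : ℝ} (hd : 0 < d) (ρ₀ : TrDiv hT) :
    ∃ ρ : Hdiv Ω, skelDiv hT ρ = ρ₀ ∧ ∀ i, HasWeakGrad (T i)
      (restrictLp (hT.subset i) (d ^ 2 • ρ.1.2)) (restrictLp (hT.subset i) ρ.1.1) := by
  obtain ⟨ρ, hρ⟩ := ρ₀.2
  have hmin : ∃ q, skelDiv hT q = skelDiv hT ρ ∧ ∀ t, skelDiv hT t = 0 →
      1 * (inner ℝ q.1.1 t.1.1 : ℝ) + d ^ 2 * inner ℝ q.1.2 t.1.2 = 0 :=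
    exists_minimal_of_isClosed_ker (Hdiv Ω) _ (isClosed_ker_skelDiv hT) one_pos (by positivity) ρ
  obtain ⟨q, hq, h⟩ := hmin
  refine ⟨q, hq.trans hρ, fun i => hasWeakGrad_iff.2 fun φ hφ e => ?_⟩
  have h1 : 1 * (inner ℝ q.1.1 (testField (hφ.mono (hT.subset i)) e) : ℝ)
      + d ^ 2 * inner ℝ q.1.2 (testDiv (hφ.mono (hT.subset i)) e) = 0 :=
    h (testHdiv (hφ.mono (hT.subset i)) e) (skelDiv_testHdiv hT hφ e)
  rw [inner_restrictLp_testField, inner_restrictLp_testDiv, real_inner_smul_left]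
  linarith

end

section

/-! ### Galerkin orthogonality -/

/-- On `Uh` the form `b w (Θ w')` is symmetric and definite, so injectivity gives solvability by a
dimension count. Best approximation is Pythagoras applied to `u - w = (u - uh) + (uh - w)`. -/
theorem existsUnique_galerkin {U V : Type*} [AddCommGroup U] [Module ℝ U] (b : U →ₗ[ℝ] (V → ℝ))
    (g : V → V → ℝ) (hsymm : ∀ v w, g v w = g w v) (hnonneg : ∀ v, 0 ≤ g v v) (Θ : U → V)
    (hΘ : ∀ w v, g (Θ w) v = b w v) (hpos : ∀ w, g (Θ w) (Θ w) = 0 → w = 0)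
    (Uh : Submodule ℝ U) [FiniteDimensional ℝ Uh] (u : U) :
    (∃! uh, uh ∈ Uh ∧ ∀ w ∈ Uh, b uh (Θ w) = b u (Θ w)) ∧
    ∀ uh, uh ∈ Uh → (∀ w ∈ Uh, b uh (Θ w) = b u (Θ w)) → ∀ w ∈ Uh,
      g (Θ (u - uh)) (Θ (u - uh)) ≤ g (Θ (u - w)) (Θ (u - w)) := by
  have hs : ∀ w w', b w (Θ w') = b w' (Θ w) := fun w w' => by rw [← hΘ, ← hΘ, hsymm]
  -- Linearity of `Θ` is not available, as `V` has no algebraic structure here; linearity in the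
  -- second slot is carried over from the first by symmetry.
  let a : U →ₗ[ℝ] U →ₗ[ℝ] ℝ := LinearMap.mk₂ ℝ (fun w w' => b w (Θ w'))
    (fun m m' k => by rw [map_add, Pi.add_apply]) (fun c m k => by rw [map_smul, Pi.smul_apply])
    (fun m k k' => by rw [hs, map_add, Pi.add_apply, hs k, hs k'])
    (fun c m k => by rw [hs, map_smul, Pi.smul_apply, hs k])
  have ha : ∀ w w', a w w' = b w (Θ w') := fun w w' => rfl
  have hg : ∀ w, g (Θ w) (Θ w) = a w w := fun w => hΘ w _
  let A : Uh →ₗ[ℝ] Module.Dual ℝ Uh := a.domRestrict₁₂ Uh Uh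
  have hA : ∀ w w' : Uh, A w w' = a w w' := fun w w' => rfl
  have hinj : Function.Injective A := (injective_iff_map_eq_zero A).2 fun w hw => by
    refine Subtype.ext (hpos _ ?_)
    rw [hg, ← hA, hw, LinearMap.zero_apply]
  have hsurj : Function.Surjective A :=
    (LinearMap.injective_iff_surjective_of_finrank_eq_finrank
      (Subspace.dual_finrank_eq (K := ℝ) (V := Uh)).symm).1 hinj
  refine ⟨?_, fun uh huh h w hw => ?_⟩
  · obtain ⟨uh, h⟩ := hsurj ((a u).domRestrict Uh)
    refine ⟨uh, ⟨uh.2, fun w hw => LinearMap.congr_fun h ⟨w, hw⟩⟩, ?_⟩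
    rintro y ⟨hy, hy'⟩
    refine congrArg Subtype.val (hinj (a₁ := ⟨y, hy⟩) (a₂ := uh) (LinearMap.ext fun w => ?_))
    rw [h]
    exact hy' w w.2
  · have hsplit : u - w = (u - uh) + (uh - w) := by abel
    have h0 : a (u - uh) (uh - w) = 0 := by
      rw [ha, map_sub, Pi.sub_apply, h _ (Uh.sub_mem huh hw), sub_self]
    have h0' : a (uh - w) (u - uh) = 0 := by rw [ha, hs, ← ha, h0]
    have h1 : 0 ≤ a (uh - w) (uh - w) := by rw [← hg]; exact hnonneg _
    rw [hg, hg, hsplit]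
    simp only [map_add, LinearMap.add_apply, h0, h0']
    linarith

/-! ### Cauchy–Schwarz inequalities -/

theorem inner_add_inner_le {X Y : Type*} [NormedAddCommGroup X] [InnerProductSpace ℝ X]
    [NormedAddCommGroup Y] [InnerProductSpace ℝ Y] {c : ℝ} (hc : 0 < c) (x x' : X) (y y' : Y) :
    (inner ℝ x x' : ℝ) + inner ℝ y y'
      ≤ √(c⁻¹ * ‖x‖ ^ 2 + ‖y‖ ^ 2) * √(c * ‖x'‖ ^ 2 + ‖y'‖ ^ 2) := by
  rw [← Real.sqrt_mul (by positivity)]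
  refine Real.le_sqrt_of_sq_le ?_
  have h1 := abs_real_inner_le_norm x x'
  have h2 := abs_real_inner_le_norm y y'
  have h3 : ((inner ℝ x x' : ℝ) + inner ℝ y y') ^ 2 ≤ (‖x‖ * ‖x'‖ + ‖y‖ * ‖y'‖) ^ 2 := by
    refine sq_le_sq.2 ((abs_add_le _ _).trans ((add_le_add h1 h2).trans (le_abs_self _)))
  refine h3.trans ?_
  have hc' : c⁻¹ * c = 1 := inv_mul_cancel₀ hc.ne'
  -- Lagrange's identity: the last term is the defect in the Cauchy–Schwarz inequality.
  have e : (c⁻¹ * ‖x‖ ^ 2 + ‖y‖ ^ 2) * (c * ‖x'‖ ^ 2 + ‖y'‖ ^ 2)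
      = (‖x‖ * ‖x'‖ + ‖y‖ * ‖y'‖) ^ 2 + c⁻¹ * (‖x‖ * ‖y'‖ - c * (‖x'‖ * ‖y‖)) ^ 2 := by
    linear_combination (‖x‖ ^ 2 * ‖x'‖ ^ 2 + 2 * ‖x‖ * ‖y'‖ * ‖x'‖ * ‖y‖
      - c * ‖x'‖ ^ 2 * ‖y‖ ^ 2) * hc'
  rw [e]
  have : 0 ≤ c⁻¹ * (‖x‖ * ‖y'‖ - c * (‖x'‖ * ‖y‖)) ^ 2 := by positivity
  linarith

theorem sum_inner_add_inner_le {ι : Type*} [Fintype ι] {X Y : ι → Type*}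
    [∀ i, NormedAddCommGroup (X i)] [∀ i, InnerProductSpace ℝ (X i)]
    [∀ i, NormedAddCommGroup (Y i)] [∀ i, InnerProductSpace ℝ (Y i)] {c : ℝ} (hc : 0 < c)
    (x x' : ∀ i, X i) (y y' : ∀ i, Y i) :
    ∑ i, ((inner ℝ (x i) (x' i) : ℝ) + inner ℝ (y i) (y' i))
      ≤ √(∑ i, (c⁻¹ * ‖x i‖ ^ 2 + ‖y i‖ ^ 2)) * √(∑ i, (c * ‖x' i‖ ^ 2 + ‖y' i‖ ^ 2)) := by
  refine (Finset.sum_le_sum fun i _ => inner_add_inner_le hc (x i) (x' i) (y i) (y' i)).trans ?_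
  exact Real.sum_sqrt_mul_sqrt_le _ (fun i => by positivity) (fun i => by positivity)

theorem exists_riesz_submodule {X Y : Type*} [NormedAddCommGroup X] [InnerProductSpace ℝ X]
    [NormedAddCommGroup Y] [InnerProductSpace ℝ Y] [CompleteSpace X] [CompleteSpace Y]
    (S : Submodule ℝ (X × Y)) [CompleteSpace S] {a b : ℝ} (ha : 0 < a) (hb : 0 < b) (x : X)
    (y : Y) : ∃ s : S, ∀ t : S, a * (inner ℝ s.1.1 t.1.1 : ℝ) + b * inner ℝ s.1.2 t.1.2
      = inner ℝ x t.1.1 + inner ℝ y t.1.2 :=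
  exists_riesz_prod (V := S) S.subtypeL (fun _ => rfl) ha hb
    ((innerSL ℝ x).comp ((ContinuousLinearMap.fst ℝ X Y).comp S.subtypeL)
      + (innerSL ℝ y).comp ((ContinuousLinearMap.snd ℝ X Y).comp S.subtypeL))

variable {n : ℕ} {D Ω : Set (Eu n)} {ι : Type*} [Fintype ι] {T : ι → Set (Eu n)}
  (hT : IsMesh Ω T)

/-! ### The bilinear form and the test inner product -/

/-- The bilinear form `b` as a linear map of its first argument. -/
def bilinBLin : TrialSpace hT →ₗ[ℝ] (TestSpace T → ℝ) where
  toFun := bilinB hT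
  map_add' u u' := by
    funext v
    have e1 : (u.2.2.1 + u'.2.2.1).1 v.2 = u.2.2.1.1 v.2 + u'.2.2.1.1 v.2 := rfl
    have e2 : (u.2.2.2 + u'.2.2.2).1 v.1 = u.2.2.2.1 v.1 + u'.2.2.2.1 v.1 := rfl
    simp only [bilinB, Pi.add_apply, e1, e2, Prod.fst_add, Prod.snd_add, map_add, inner_add_left,
      Finset.sum_add_distrib]
    ring
  map_smul' c u := by
    funext v
    have e1 : (c • u.2.2.1).1 v.2 = c * u.2.2.1.1 v.2 := rfl
    have e2 : (c • u.2.2.2).1 v.1 = c * u.2.2.2.1 v.1 := rfl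
    simp only [bilinB, Pi.smul_apply, e1, e2, Prod.smul_fst, Prod.smul_snd, map_smul,
      real_inner_smul_left, RingHom.id_apply, smul_eq_mul, ← mul_add, ← Finset.mul_sum]
    ring

/-- The squared norm `d⁻²‖v‖² + ‖∇v‖²` of the broken space `H¹(𝒯)`. -/
def sqH1 (T : ι → Set (Eu n)) (d : ℝ) (v : BrokenH1 T) : ℝ :=
  ∑ i, ((d ^ 2)⁻¹ * ‖(v i).1.1‖ ^ 2 + ‖(v i).1.2‖ ^ 2)

/-- The squared norm `d²‖div τ‖² + ‖τ‖²` of the broken space `H(div, 𝒯)`. -/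
def sqHdiv (T : ι → Set (Eu n)) (d : ℝ) (τ : BrokenHdiv T) : ℝ :=
  ∑ i, (d ^ 2 * ‖(τ i).1.2‖ ^ 2 + ‖(τ i).1.1‖ ^ 2)

theorem sqH1_nonneg (d : ℝ) (v : BrokenH1 T) : 0 ≤ sqH1 T d v :=
  Finset.sum_nonneg fun i _ => by positivity

theorem sqHdiv_nonneg (d : ℝ) (τ : BrokenHdiv T) : 0 ≤ sqHdiv T d τ :=
  Finset.sum_nonneg fun i _ => by positivity

theorem innerV_self (d : ℝ) (v : TestSpace T) :
    innerV T d v v = sqH1 T d v.1 + sqHdiv T d v.2 := by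
  simp only [innerV, sqH1, sqHdiv, real_inner_self_eq_norm_sq, ← Finset.sum_add_distrib]
  exact Finset.sum_congr rfl fun i _ => by ring

theorem innerV_comm (d : ℝ) (v w : TestSpace T) : innerV T d v w = innerV T d w v := by
  refine Finset.sum_congr rfl fun i _ => ?_
  rw [real_inner_comm (w.1 i).1.1, real_inner_comm (w.1 i).1.2, real_inner_comm (w.2 i).1.1,
    real_inner_comm (w.2 i).1.2]

theorem sqH1_toBrokenH1 (d : ℝ) (v : H1 Ω) : sqH1 T d (toBrokenH1 hT v)
    = (d ^ 2)⁻¹ * ‖v.1.1‖ ^ 2 + ‖v.1.2‖ ^ 2 := by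
  rw [sqH1, Finset.sum_add_distrib, ← Finset.mul_sum, ← hT.sum_norm_restrictLp v.1.1,
    ← hT.sum_norm_restrictLp v.1.2]
  rfl

theorem sqHdiv_toBrokenHdiv (d : ℝ) (τ : Hdiv Ω) : sqHdiv T d (toBrokenHdiv hT τ)
    = d ^ 2 * ‖τ.1.2‖ ^ 2 + ‖τ.1.1‖ ^ 2 := by
  rw [sqHdiv, Finset.sum_add_distrib, ← Finset.mul_sum, ← hT.sum_norm_restrictLp τ.1.1,
    ← hT.sum_norm_restrictLp τ.1.2]
  rfl

theorem innerV_le {d : ℝ} (hd : 0 < d) (v w : TestSpace T) :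
    innerV T d v w ≤ √(innerV T d v v) * √(innerV T d w w) := by
  have hd2 : 0 < d ^ 2 := by positivity
  have h1 : ∑ i, ((d ^ 2)⁻¹ * (inner ℝ (v.1 i).1.1 (w.1 i).1.1 : ℝ)
      + inner ℝ (v.1 i).1.2 (w.1 i).1.2) ≤ √(sqH1 T d v.1) * √(sqH1 T d w.1) := by
    -- Rescaling the first argument by `d⁻²` puts the weight into the product, and leaves `d² (d⁻²)²
    -- = d⁻²` in the norm.
    have h := sum_inner_add_inner_le (c := (d ^ 2)⁻¹) (by positivity)
      (fun i => (d ^ 2)⁻¹ • (v.1 i).1.1) (fun i => (w.1 i).1.1) (fun i => (v.1 i).1.2)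
      (fun i => (w.1 i).1.2)
    simp only [real_inner_smul_left, norm_smul, inv_inv, mul_pow] at h
    have e : ∀ i, d ^ 2 * (‖(d ^ 2)⁻¹‖ ^ 2 * ‖(v.1 i).1.1‖ ^ 2) = (d ^ 2)⁻¹ * ‖(v.1 i).1.1‖ ^ 2 :=
      fun i => by rw [Real.norm_of_nonneg (by positivity)]; field_simp
    simp only [e] at h
    exact h
  have h2 : ∑ i, (d ^ 2 * (inner ℝ (v.2 i).1.2 (w.2 i).1.2 : ℝ)
      + inner ℝ (v.2 i).1.1 (w.2 i).1.1) ≤ √(sqHdiv T d v.2) * √(sqHdiv T d w.2) := by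
    have h := sum_inner_add_inner_le (c := d ^ 2) (by positivity)
      (fun i => d ^ 2 • (v.2 i).1.2) (fun i => (w.2 i).1.2) (fun i => (v.2 i).1.1)
      (fun i => (w.2 i).1.1)
    simp only [real_inner_smul_left, norm_smul, mul_pow] at h
    have e : ∀ i, (d ^ 2)⁻¹ * (‖d ^ 2‖ ^ 2 * ‖(v.2 i).1.2‖ ^ 2) = d ^ 2 * ‖(v.2 i).1.2‖ ^ 2 :=
      fun i => by rw [Real.norm_of_nonneg (by positivity)]; field_simp
    simp only [e] at h
    exact h
  have e : innerV T d v w = ∑ i, ((d ^ 2)⁻¹ * (inner ℝ (v.1 i).1.1 (w.1 i).1.1 : ℝ)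
      + inner ℝ (v.1 i).1.2 (w.1 i).1.2) + ∑ i, (d ^ 2 * (inner ℝ (v.2 i).1.2 (w.2 i).1.2 : ℝ)
      + inner ℝ (v.2 i).1.1 (w.2 i).1.1) := by
    rw [← Finset.sum_add_distrib]
    exact Finset.sum_congr rfl fun i _ => by ring
  rw [e, innerV_self, innerV_self]
  refine (add_le_add h1 h2).trans ?_
  rw [← Real.sqrt_mul (add_nonneg (sqH1_nonneg _ _) (sqHdiv_nonneg _ _))]
  refine Real.le_sqrt_of_sq_le ?_
  have a1 := Real.sq_sqrt (sqH1_nonneg d v.1)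
  have a2 := Real.sq_sqrt (sqH1_nonneg d w.1)
  have a3 := Real.sq_sqrt (sqHdiv_nonneg d v.2)
  have a4 := Real.sq_sqrt (sqHdiv_nonneg d w.2)
  generalize √(sqH1 T d v.1) = p at *
  generalize √(sqH1 T d w.1) = q at *
  generalize √(sqHdiv T d v.2) = r at *
  generalize √(sqHdiv T d w.2) = s at *
  rw [← a1, ← a2, ← a3, ← a4]
  nlinarith [sq_nonneg (p * s - q * r)]

/-- The trace terms of the bilinear form, written elementwise. -/
theorem bilinB_eq_sum {w : H1 Ω} {ρ : Hdiv Ω} {u : TrialSpace hT} (hw : skelGrad hT w = u.2.2.1)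
    (hρ : skelDiv hT ρ = u.2.2.2) (v : TestSpace T) : bilinB hT u v =
    ∑ i, ((inner ℝ (restrictLp (hT.subset i) u.1 - restrictLp (hT.subset i) w.1.1)
        (v.2 i).1.2 : ℝ)
      + inner ℝ (restrictLp (hT.subset i) u.2.1 - restrictLp (hT.subset i) w.1.2) (v.2 i).1.1)
    + ∑ i, ((inner ℝ (-restrictLp (hT.subset i) ρ.1.2) (v.1 i).1.1 : ℝ)
      + inner ℝ (restrictLp (hT.subset i) u.2.1 - restrictLp (hT.subset i) ρ.1.1)
        (v.1 i).1.2) := by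
  have e1 := (congrArg (fun l => l v.2) hw.symm).trans (skelGrad_apply hT w v.2)
  have e2 := (congrArg (fun l => l v.1) hρ.symm).trans (skelDiv_apply hT ρ v.1)
  have e0 : bilinB hT u v = (∑ i, ((inner ℝ (restrictLp (hT.subset i) u.1) (v.2 i).1.2 : ℝ)
      + inner ℝ (restrictLp (hT.subset i) u.2.1) ((v.2 i).1.1 + (v.1 i).1.2)))
      - u.2.2.1.1 v.2 - u.2.2.2.1 v.1 := rfl
  refine (e0.trans (congrArg₂ (fun x y => _ - x - y) e1 e2)).trans ?_
  simp only [inner_sub_left, inner_neg_left, inner_add_right, Finset.sum_add_distrib,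
    Finset.sum_sub_distrib, Finset.sum_neg_distrib]
  ring

theorem innerV_eq_sum (d : ℝ) (θ v : TestSpace T) : innerV T d θ v
      = ∑ i, (1 * (inner ℝ (θ.2 i).1.1 (v.2 i).1.1 : ℝ)
          + d ^ 2 * inner ℝ (θ.2 i).1.2 (v.2 i).1.2)
        + ∑ i, ((d ^ 2)⁻¹ * (inner ℝ (θ.1 i).1.1 (v.1 i).1.1 : ℝ)
          + 1 * inner ℝ (θ.1 i).1.2 (v.1 i).1.2) := by
  rw [innerV, ← Finset.sum_add_distrib]
  exact Finset.sum_congr rfl fun i _ => by ring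

/-- The test product decouples over the elements, and on each of them into its `H¹` and `H(div)`
parts, so each block has its own Riesz representative. -/
theorem exists_innerV_eq {d : ℝ} (hd : 0 < d) (a : ∀ i, L2 (T i)) (b : ∀ i, L2v (T i))
    (a' : ∀ i, L2 (T i)) (b' : ∀ i, L2v (T i)) : ∃ θ : TestSpace T, ∀ v, innerV T d θ v
      = ∑ i, ((inner ℝ (a i) (v.2 i).1.2 : ℝ) + inner ℝ (b i) (v.2 i).1.1)
        + ∑ i, ((inner ℝ (a' i) (v.1 i).1.1 : ℝ) + inner ℝ (b' i) (v.1 i).1.2) := by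
  have hd2 : 0 < d ^ 2 := by positivity
  have h1 : ∀ i, ∃ s : H1 (T i), ∀ t : H1 (T i),
      (d ^ 2)⁻¹ * (inner ℝ s.1.1 t.1.1 : ℝ) + 1 * inner ℝ s.1.2 t.1.2
        = inner ℝ (a' i) t.1.1 + inner ℝ (b' i) t.1.2 :=
    fun i => exists_riesz_submodule (H1 (T i)) (inv_pos.2 hd2) one_pos (a' i) (b' i)
  have h2 : ∀ i, ∃ s : Hdiv (T i), ∀ t : Hdiv (T i),
      1 * (inner ℝ s.1.1 t.1.1 : ℝ) + d ^ 2 * inner ℝ s.1.2 t.1.2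
        = inner ℝ (b i) t.1.1 + inner ℝ (a i) t.1.2 :=
    fun i => exists_riesz_submodule (Hdiv (T i)) one_pos hd2 (b i) (a i)
  choose s1 hs1 using h1
  choose s2 hs2 using h2
  refine ⟨(s1, s2), fun v => (innerV_eq_sum d (s1, s2) v).trans ?_⟩
  refine congrArg₂ (· + ·) (Finset.sum_congr rfl fun i _ => ?_)
    (Finset.sum_congr rfl fun i _ => hs1 i (v.1 i))
  exact (hs2 i (v.2 i)).trans (add_comm _ _)

/-- Once the traces are replaced by arbitrary extensions, `b(u, ·)` is a sum of local `L₂`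
functionals of `v`, `∇v`, `τ` and `div τ`. -/
theorem exists_isOptimalTest {d : ℝ} (hd : 0 < d) (u : TrialSpace hT) :
    ∃ θ : TestSpace T, IsOptimalTest hT d u θ := by
  obtain ⟨w, -, hw⟩ := u.2.2.1.2
  obtain ⟨ρ, hρ⟩ := u.2.2.2.2
  obtain ⟨θ, hθ⟩ := exists_innerV_eq hd
    (fun i => restrictLp (hT.subset i) u.1 - restrictLp (hT.subset i) w.1.1)
    (fun i => restrictLp (hT.subset i) u.2.1 - restrictLp (hT.subset i) w.1.2)
    (fun i => -restrictLp (hT.subset i) ρ.1.2)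
    (fun i => restrictLp (hT.subset i) u.2.1 - restrictLp (hT.subset i) ρ.1.1)
  exact ⟨θ, fun v => (hθ v).trans (bilinB_eq_sum hT hw hρ v).symm⟩

theorem eq_of_forall_innerV_eq {d : ℝ} (hd : 0 < d) {θ s : TestSpace T}
    (h : ∀ v, innerV T d θ v = innerV T d s v) : θ = s := by
  have h0 := h (fun i => θ.1 i - s.1 i, fun i => θ.2 i - s.2 i)
  have h1 : ∑ i, ((d ^ 2)⁻¹ * ‖(θ.1 i).1.1 - (s.1 i).1.1‖ ^ 2 + ‖(θ.1 i).1.2 - (s.1 i).1.2‖ ^ 2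
      + ‖(θ.2 i).1.1 - (s.2 i).1.1‖ ^ 2 + d ^ 2 * ‖(θ.2 i).1.2 - (s.2 i).1.2‖ ^ 2) = 0 := by
    rw [← sub_eq_zero, innerV, innerV, ← Finset.sum_sub_distrib] at h0
    refine Eq.trans (Finset.sum_congr rfl fun i _ => ?_) h0
    change _ = (d ^ 2)⁻¹ * (inner ℝ (θ.1 i).1.1 ((θ.1 i).1.1 - (s.1 i).1.1) : ℝ)
      + inner ℝ (θ.1 i).1.2 ((θ.1 i).1.2 - (s.1 i).1.2)
      + inner ℝ (θ.2 i).1.1 ((θ.2 i).1.1 - (s.2 i).1.1)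
      + d ^ 2 * inner ℝ (θ.2 i).1.2 ((θ.2 i).1.2 - (s.2 i).1.2)
      - ((d ^ 2)⁻¹ * (inner ℝ (s.1 i).1.1 ((θ.1 i).1.1 - (s.1 i).1.1) : ℝ)
      + inner ℝ (s.1 i).1.2 ((θ.1 i).1.2 - (s.1 i).1.2)
      + inner ℝ (s.2 i).1.1 ((θ.2 i).1.1 - (s.2 i).1.1)
      + d ^ 2 * inner ℝ (s.2 i).1.2 ((θ.2 i).1.2 - (s.2 i).1.2))
    simp only [← real_inner_self_eq_norm_sq]
    simp only [inner_sub_left]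
    ring
  have h2 := (Finset.sum_eq_zero_iff_of_nonneg fun i _ => by positivity).1 h1
  have key : ∀ {a b c e : ℝ}, 0 ≤ a → 0 ≤ b → 0 ≤ c → 0 ≤ e →
      (d ^ 2)⁻¹ * a ^ 2 + b ^ 2 + c ^ 2 + d ^ 2 * e ^ 2 = 0 → a = 0 ∧ b = 0 ∧ c = 0 ∧ e = 0 := by
    intro a b c e _ _ _ _ h
    have p1 : 0 ≤ (d ^ 2)⁻¹ * a ^ 2 := by positivity
    have p2 : 0 ≤ d ^ 2 * e ^ 2 := by positivity
    have q1 : (d ^ 2)⁻¹ * a ^ 2 = 0 := by nlinarith [sq_nonneg b, sq_nonneg c]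
    have q2 : d ^ 2 * e ^ 2 = 0 := by nlinarith [sq_nonneg b, sq_nonneg c]
    have q3 : b ^ 2 = 0 := by nlinarith [sq_nonneg b, sq_nonneg c]
    have q4 : c ^ 2 = 0 := by nlinarith [sq_nonneg b, sq_nonneg c]
    have hd' := hd.ne'
    simp_all
  have h3 := fun i => key (norm_nonneg _) (norm_nonneg _) (norm_nonneg _) (norm_nonneg _)
    (h2 i (Finset.mem_univ i))
  simp only [norm_eq_zero, sub_eq_zero] at h3
  exact Prod.ext (funext fun i => Subtype.ext (Prod.ext (h3 i).1 (h3 i).2.1))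
    (funext fun i => Subtype.ext (Prod.ext (h3 i).2.2.1 (h3 i).2.2.2))

end

section

variable {n : ℕ} {D Ω : Set (Eu n)} {ι : Type*} [Fintype ι] {T : ι → Set (Eu n)}
  (hT : IsMesh Ω T)

/-! ### Elementwise pairings -/

/-- The elementwise pairing `(a, div τ)_𝒯 + (b, τ)_𝒯`. -/
def pairHdiv (a : L2 Ω) (b : L2v Ω) (τ : BrokenHdiv T) : ℝ :=
  ∑ i, ((inner ℝ (restrictLp (hT.subset i) a) (τ i).1.2 : ℝ)
    + inner ℝ (restrictLp (hT.subset i) b) (τ i).1.1)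

/-- The elementwise pairing `(a, v)_𝒯 + (b, ∇v)_𝒯`. -/
def pairH1 (a : L2 Ω) (b : L2v Ω) (v : BrokenH1 T) : ℝ :=
  ∑ i, ((inner ℝ (restrictLp (hT.subset i) a) (v i).1.1 : ℝ)
    + inner ℝ (restrictLp (hT.subset i) b) (v i).1.2)

theorem skelGrad_eq_pairHdiv (w : H1 Ω) (τ : BrokenHdiv T) :
    skelGrad hT w τ = pairHdiv hT w.1.1 w.1.2 τ :=
  skelGrad_apply hT w τ

theorem skelDiv_eq_pairH1 (ρ : Hdiv Ω) (v : BrokenH1 T) :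
    skelDiv hT ρ v = pairH1 hT ρ.1.2 ρ.1.1 v :=
  (skelDiv_apply hT ρ v).trans (Finset.sum_congr rfl fun _ _ => add_comm _ _)

theorem pairHdiv_toBrokenHdiv (a : L2 Ω) (b : L2v Ω) (τ : Hdiv Ω) :
    pairHdiv hT a b (toBrokenHdiv hT τ) = (inner ℝ a τ.1.2 : ℝ) + inner ℝ b τ.1.1 := by
  rw [pairHdiv, Finset.sum_add_distrib, ← hT.sum_inner_restrictLp a, ← hT.sum_inner_restrictLp b]
  rfl

theorem pairH1_toBrokenH1 (a : L2 Ω) (b : L2v Ω) (v : H1 Ω) :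
    pairH1 hT a b (toBrokenH1 hT v) = (inner ℝ a v.1.1 : ℝ) + inner ℝ b v.1.2 := by
  rw [pairH1, Finset.sum_add_distrib, ← hT.sum_inner_restrictLp a, ← hT.sum_inner_restrictLp b]
  rfl

theorem pairHdiv_neg (a : L2 Ω) (b : L2v Ω) (τ : BrokenHdiv T) :
    pairHdiv hT (-a) (-b) τ = -pairHdiv hT a b τ := by
  rw [pairHdiv, pairHdiv, ← Finset.sum_neg_distrib]
  refine Finset.sum_congr rfl fun i _ => ?_
  rw [map_neg, map_neg, inner_neg_left, inner_neg_left, neg_add]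

theorem pairH1_neg (a : L2 Ω) (b : L2v Ω) (v : BrokenH1 T) :
    pairH1 hT (-a) (-b) v = -pairH1 hT a b v := by
  rw [pairH1, pairH1, ← Finset.sum_neg_distrib]
  refine Finset.sum_congr rfl fun i _ => ?_
  rw [map_neg, map_neg, inner_neg_left, inner_neg_left, neg_add]

theorem pairHdiv_zero (a : L2 Ω) (b : L2v Ω) : pairHdiv hT a b 0 = 0 :=
  Finset.sum_eq_zero fun i _ => by
    have h : (inner ℝ (restrictLp (hT.subset i) a) (0 : L2 (T i)) : ℝ)
      + inner ℝ (restrictLp (hT.subset i) b) (0 : L2v (T i)) = 0 := by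
      rw [inner_zero_right, inner_zero_right, add_zero]
    exact h

theorem pairH1_zero (a : L2 Ω) (b : L2v Ω) : pairH1 hT a b 0 = 0 :=
  Finset.sum_eq_zero fun i _ => by
    have h : (inner ℝ (restrictLp (hT.subset i) a) (0 : L2 (T i)) : ℝ)
      + inner ℝ (restrictLp (hT.subset i) b) (0 : L2v (T i)) = 0 := by
      rw [inner_zero_right, inner_zero_right, add_zero]
    exact h

theorem abs_pairHdiv_le {d : ℝ} (hd : 0 < d) (a : L2 Ω) (b : L2v Ω) (τ : BrokenHdiv T) :
    |pairHdiv hT a b τ| ≤ √((d ^ 2)⁻¹ * ‖a‖ ^ 2 + ‖b‖ ^ 2) * √(sqHdiv T d τ) := by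
  have key : ∀ (a : L2 Ω) (b : L2v Ω),
      pairHdiv hT a b τ ≤ √((d ^ 2)⁻¹ * ‖a‖ ^ 2 + ‖b‖ ^ 2) * √(sqHdiv T d τ) := fun a b => by
    rw [← hT.sum_norm_restrictLp a, ← hT.sum_norm_restrictLp b, Finset.mul_sum,
      ← Finset.sum_add_distrib]
    exact sum_inner_add_inner_le (by positivity) (fun i => restrictLp (hT.subset i) a)
      (fun i => (τ i).1.2) (fun i => restrictLp (hT.subset i) b) (fun i => (τ i).1.1)
  refine abs_le'.2 ⟨key a b, ?_⟩
  have h := key (-a) (-b)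
  rwa [norm_neg, norm_neg, pairHdiv_neg] at h

theorem abs_pairH1_le {d : ℝ} (hd : 0 < d) (a : L2 Ω) (b : L2v Ω) (v : BrokenH1 T) :
    |pairH1 hT a b v| ≤ √(d ^ 2 * ‖a‖ ^ 2 + ‖b‖ ^ 2) * √(sqH1 T d v) := by
  have key : ∀ (a : L2 Ω) (b : L2v Ω),
      pairH1 hT a b v ≤ √(d ^ 2 * ‖a‖ ^ 2 + ‖b‖ ^ 2) * √(sqH1 T d v) := fun a b => by
    rw [← hT.sum_norm_restrictLp a, ← hT.sum_norm_restrictLp b, Finset.mul_sum,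
      ← Finset.sum_add_distrib]
    have h := sum_inner_add_inner_le (c := (d ^ 2)⁻¹) (by positivity)
      (fun i => restrictLp (hT.subset i) a)
      (fun i => (v i).1.1) (fun i => restrictLp (hT.subset i) b) (fun i => (v i).1.2)
    rw [inv_inv] at h
    exact h
  refine abs_le'.2 ⟨key a b, ?_⟩
  have h := key (-a) (-b)
  rwa [norm_neg, norm_neg, pairH1_neg] at h

/-- The duality `⟨û, τ⟩_𝒮`. -/
def evalTrGrad (w : TrGrad hT) (τ : BrokenHdiv T) : ℝ := w.1 τ

/-- The duality `⟨σ̂, v⟩_𝒮`. -/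
def evalTrDiv (ρ : TrDiv hT) (v : BrokenH1 T) : ℝ := ρ.1 v

theorem evalTrGrad_eq {w₀ : TrGrad hT} {w : H1 Ω} (hw : skelGrad hT w = w₀) (τ : BrokenHdiv T) :
    evalTrGrad hT w₀ τ = pairHdiv hT w.1.1 w.1.2 τ :=
  (congrArg (fun l => l τ) hw.symm).trans (skelGrad_eq_pairHdiv hT w τ)

theorem evalTrDiv_eq {ρ₀ : TrDiv hT} {ρ : Hdiv Ω} (hρ : skelDiv hT ρ = ρ₀) (v : BrokenH1 T) :
    evalTrDiv hT ρ₀ v = pairH1 hT ρ.1.2 ρ.1.1 v :=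
  (congrArg (fun l => l v) hρ.symm).trans (skelDiv_eq_pairH1 hT ρ v)

/-- Conforming fields have no jumps across the skeleton, and the zero boundary value built into
`TrGrad` removes the contribution of `∂Ω`. For normal traces the boundary condition has to come from
the test function instead. -/
theorem evalTrGrad_toBrokenHdiv (w₀ : TrGrad hT) (τ : Hdiv Ω) :
    evalTrGrad hT w₀ (toBrokenHdiv hT τ) = 0 := by
  obtain ⟨w, hw0, hw⟩ := w₀.2
  rw [evalTrGrad_eq hT hw, pairHdiv_toBrokenHdiv]
  exact inner_add_inner_eq_zero_of_mem_H10 hw0 τ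

theorem evalTrDiv_toBrokenH1 (ρ₀ : TrDiv hT) {v : H1 Ω} (hv : v ∈ H10 Ω) :
    evalTrDiv hT ρ₀ (toBrokenH1 hT v) = 0 := by
  obtain ⟨ρ, hρ⟩ := ρ₀.2
  exact (evalTrDiv_eq hT hρ _).trans ((pairH1_toBrokenH1 hT ρ.1.2 ρ.1.1 v).trans
    ((congrArg₂ (· + ·) (real_inner_comm v.1.1 ρ.1.2) (real_inner_comm v.1.2 ρ.1.1)).trans
    (inner_add_inner_eq_zero_of_mem_H10 hv ρ)))

theorem evalTrGrad_zero (w₀ : TrGrad hT) : evalTrGrad hT w₀ 0 = 0 := map_zero w₀.1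

theorem evalTrDiv_zero (ρ₀ : TrDiv hT) : evalTrDiv hT ρ₀ 0 = 0 := map_zero ρ₀.1

theorem sum_eq_sum_add_sum {f g h : ι → ℝ} (hf : ∀ i, f i = g i + h i) :
    ∑ i, f i = ∑ i, g i + ∑ i, h i := by
  rw [← Finset.sum_add_distrib]
  exact Finset.sum_congr rfl fun i _ => hf i

theorem inner_add_inner_add {X Y : Type*} [NormedAddCommGroup X] [InnerProductSpace ℝ X]
    [NormedAddCommGroup Y] [InnerProductSpace ℝ Y] (a x : X) {z : X} (hz : z = 0) (y : X)
    (s t g : Y) : (inner ℝ a x : ℝ) + inner ℝ s (t + g)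
      = inner ℝ a x + inner ℝ s t + (inner ℝ z y + inner ℝ s g) := by
  rw [hz, inner_zero_left, inner_add_right]
  ring

theorem bilinB_eq (u : TrialSpace hT) (v : TestSpace T) : bilinB hT u v
    = pairHdiv hT u.1 u.2.1 v.2 + pairH1 hT 0 u.2.1 v.1 - evalTrGrad hT u.2.2.1 v.2
      - evalTrDiv hT u.2.2.2 v.1 := by
  have e : ∑ i, ((inner ℝ (restrictLp (hT.subset i) u.1) (v.2 i).1.2 : ℝ)
      + inner ℝ (restrictLp (hT.subset i) u.2.1) ((v.2 i).1.1 + (v.1 i).1.2))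
      = pairHdiv hT u.1 u.2.1 v.2 + pairH1 hT 0 u.2.1 v.1 :=
    sum_eq_sum_add_sum fun i => inner_add_inner_add (restrictLp (hT.subset i) u.1) (v.2 i).1.2
      (map_zero (restrictLp (hT.subset i))) (v.1 i).1.1 (restrictLp (hT.subset i) u.2.1)
      (v.2 i).1.1 (v.1 i).1.2
  exact congrArg (fun x => x - evalTrGrad hT u.2.2.1 v.2 - evalTrDiv hT u.2.2.2 v.1) e

/-! ### Minimum energy extension norms -/

theorem normTrGrad_nonneg (d : ℝ) (w : TrGrad hT) : 0 ≤ normTrGrad hT d w :=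
  Real.sInf_nonneg (by rintro _ ⟨v, -, rfl⟩; exact Real.sqrt_nonneg _)

theorem normTrDiv_nonneg (d : ℝ) (w : TrDiv hT) : 0 ≤ normTrDiv hT d w :=
  Real.sInf_nonneg (by rintro _ ⟨v, -, rfl⟩; exact Real.sqrt_nonneg _)

theorem normTrGrad_le {d : ℝ} {w₀ : TrGrad hT} {w : H1 Ω} (hw : skelGrad hT w = w₀) :
    normTrGrad hT d w₀ ≤ normH1 d w :=
  csInf_le ⟨0, by rintro _ ⟨v, -, rfl⟩; exact Real.sqrt_nonneg _⟩ ⟨w, hw, rfl⟩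

theorem normTrDiv_le {d : ℝ} {ρ₀ : TrDiv hT} {ρ : Hdiv Ω} (hρ : skelDiv hT ρ = ρ₀) :
    normTrDiv hT d ρ₀ ≤ normHdiv d ρ :=
  csInf_le ⟨0, by rintro _ ⟨v, -, rfl⟩; exact Real.sqrt_nonneg _⟩ ⟨ρ, hρ, rfl⟩

theorem le_sInf_mul {S : Set ℝ} (hS : S.Nonempty) {c x : ℝ} (hx : 0 ≤ x)
    (h : ∀ s ∈ S, c ≤ s * x) : c ≤ sInf S * x := by
  rcases hx.eq_or_lt with rfl | hx
  · obtain ⟨s, hs⟩ := hS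
    simpa using h s hs
  · rw [← div_le_iff₀ hx]
    exact le_csInf hS fun s hs => (div_le_iff₀ hx).2 (h s hs)

/-- The duality depends only on the trace, so Cauchy–Schwarz holds with every extension in `H¹(Ω)`
and therefore with the infimum of their norms. -/
theorem neg_evalTrGrad_le {d : ℝ} (hd : 0 < d) (w₀ : TrGrad hT) (τ : BrokenHdiv T) :
    -evalTrGrad hT w₀ τ ≤ normTrGrad hT d w₀ * √(sqHdiv T d τ) := by
  obtain ⟨w, -, hw⟩ := w₀.2
  refine le_sInf_mul (Nonempty.image _ (⟨w, hw⟩ : {v : H1 Ω | skelGrad hT v = w₀}.Nonempty))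
    (Real.sqrt_nonneg _) ?_
  rintro _ ⟨v, hv, rfl⟩
  rw [evalTrGrad_eq hT hv τ]
  exact (neg_le_abs _).trans (abs_pairHdiv_le hT hd v.1.1 v.1.2 τ)

theorem neg_evalTrDiv_le {d : ℝ} (hd : 0 < d) (ρ₀ : TrDiv hT) (v : BrokenH1 T) :
    -evalTrDiv hT ρ₀ v ≤ normTrDiv hT d ρ₀ * √(sqH1 T d v) := by
  obtain ⟨ρ, hρ⟩ := ρ₀.2
  refine le_sInf_mul (Nonempty.image _ (⟨ρ, hρ⟩ : {τ : Hdiv Ω | skelDiv hT τ = ρ₀}.Nonempty))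
    (Real.sqrt_nonneg _) ?_
  rintro _ ⟨η, hη, rfl⟩
  rw [evalTrDiv_eq hT hη v, normHdiv, add_comm]
  exact (neg_le_abs _).trans (abs_pairH1_le hT hd η.1.2 η.1.1 v)

/-- The part of the trial norm that stems from the field variables. -/
def normField (d : ℝ) (u : TrialSpace hT) : ℝ := √((d ^ 2)⁻¹ * ‖u.1‖ ^ 2 + ‖u.2.1‖ ^ 2)

theorem normU_sq (d : ℝ) (u : TrialSpace hT) : normU hT d u ^ 2
    = normField hT d u ^ 2 + normTrGrad hT d u.2.2.1 ^ 2 + normTrDiv hT d u.2.2.2 ^ 2 := by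
  have h1 : normField hT d u ^ 2 = (d ^ 2)⁻¹ * ‖u.1‖ ^ 2 + ‖u.2.1‖ ^ 2 :=
    Real.sq_sqrt (by positivity)
  have h2 : normU hT d u ^ 2 = (d ^ 2)⁻¹ * ‖u.1‖ ^ 2 + ‖u.2.1‖ ^ 2
      + normTrGrad hT d u.2.2.1 ^ 2 + normTrDiv hT d u.2.2.2 ^ 2 := Real.sq_sqrt (by positivity)
  exact h2.trans (congrArg (fun x => x + normTrGrad hT d u.2.2.1 ^ 2
    + normTrDiv hT d u.2.2.2 ^ 2) h1.symm)

theorem norm_le_normField (d : ℝ) (u : TrialSpace hT) : ‖u.2.1‖ ≤ normField hT d u :=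
  Real.le_sqrt_of_sq_le (by have : 0 ≤ (d ^ 2)⁻¹ * ‖u.1‖ ^ 2 := by positivity
                            linarith)

theorem sqrt_mul_norm_zero_add {X : Type*} [SeminormedAddCommGroup X] (c : ℝ) {s : ℝ}
    (hs : 0 ≤ s) : √(c * ‖(0 : X)‖ ^ 2 + s ^ 2) = s := by
  rw [norm_zero, zero_pow two_ne_zero, mul_zero, zero_add, Real.sqrt_sq hs]

theorem abs_pairH1_zero_le {d : ℝ} (hd : 0 < d) (u : TrialSpace hT) (v : BrokenH1 T) :
    |pairH1 hT 0 u.2.1 v| ≤ normField hT d u * √(sqH1 T d v) :=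
  (abs_pairH1_le hT hd 0 u.2.1 v).trans (mul_le_mul_of_nonneg_right
    ((sqrt_mul_norm_zero_add (X := L2 Ω) (d ^ 2) (norm_nonneg u.2.1)).le.trans
      (norm_le_normField hT d u)) (Real.sqrt_nonneg _))

/-! ### Continuity and stability of the ultraweak formulation -/

/-- The field norm `r` enters both test components, the trace norms one each. The constant 3 is the
largest eigenvalue of the quadratic form `(r + p)² + (r + q)²`. -/
theorem sub_sub_le_sqrt_three_mul {r p q x y P Q a b : ℝ} (hx : 0 ≤ x) (hy : 0 ≤ y)
    (hP : P ≤ r * √x) (hQ : Q ≤ r * √y) (ha : -a ≤ p * √x) (hb : -b ≤ q * √y) :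
    P + Q - a - b ≤ √(3 * (r ^ 2 + p ^ 2 + q ^ 2)) * √(y + x) := by
  rw [← Real.sqrt_mul (by positivity)]
  refine le_trans (b := (r + p) * √x + (r + q) * √y) (by linarith) (Real.le_sqrt_of_sq_le ?_)
  have a1 := Real.sq_sqrt hx
  have a2 := Real.sq_sqrt hy
  generalize √x = s at *
  generalize √y = t at *
  rw [← a1, ← a2]
  have k1 : ((r + p) * s + (r + q) * t) ^ 2 ≤ ((r + p) ^ 2 + (r + q) ^ 2) * (t ^ 2 + s ^ 2) := by
    nlinarith [sq_nonneg ((r + p) * t - (r + q) * s)]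
  have k2 : (r + p) ^ 2 + (r + q) ^ 2 ≤ 3 * (r ^ 2 + p ^ 2 + q ^ 2) := by
    nlinarith [sq_nonneg (r - p - q), sq_nonneg (p - q)]
  exact k1.trans (mul_le_mul_of_nonneg_right k2 (by positivity))

/-- Continuity of the bilinear form with constant `√3`. -/
theorem bilinB_le {d : ℝ} (hd : 0 < d) (u : TrialSpace hT) (v : TestSpace T) :
    bilinB hT u v ≤ √(3 * normU hT d u ^ 2) * √(innerV T d v v) := by
  have h := sub_sub_le_sqrt_three_mul (sqHdiv_nonneg d v.2) (sqH1_nonneg d v.1)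
    ((le_abs_self _).trans (abs_pairHdiv_le hT hd u.1 u.2.1 v.2))
    ((le_abs_self _).trans (abs_pairH1_zero_le hT hd u v.1))
    (neg_evalTrGrad_le hT hd u.2.2.1 v.2) (neg_evalTrDiv_le hT hd u.2.2.2 v.1)
  exact (bilinB_eq hT u v).le.trans (h.trans_eq (congrArg₂ (fun x y => √(3 * x) * √y)
    (normU_sq hT d u).symm (innerV_self d v).symm))

section

variable {X Y : Type*} [NormedAddCommGroup X] [InnerProductSpace ℝ X]
  [NormedAddCommGroup Y] [InnerProductSpace ℝ Y]

theorem adjoint_solution_energy {d : ℝ} {x ζ t₂ : X} {s g t₁ : Y} (ht₁ : t₁ = s - g)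
    (ht₂ : t₂ = (d ^ 2)⁻¹ • x) :
    (inner ℝ x t₂ : ℝ) + inner ℝ s t₁ + (inner ℝ (0 : X) ζ + inner ℝ s g)
      = (d ^ 2)⁻¹ * ‖x‖ ^ 2 + ‖s‖ ^ 2 := by
  rw [ht₁, ht₂, real_inner_smul_right, inner_sub_right, inner_zero_left,
    real_inner_self_eq_norm_sq, real_inner_self_eq_norm_sq]
  ring

/-- The stability bound of the adjoint problem; `(229 / 100)²` is slightly more than `3 + √5`. -/
theorem adjoint_solution_le {d : ℝ} (hd : 0 < d) {x ζ t₂ : X} {s g t₁ : Y} (ht₁ : t₁ = s - g)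
    (ht₂ : t₂ = (d ^ 2)⁻¹ • x)
    (h : (inner ℝ g g : ℝ) = inner ℝ s g + inner ℝ ((d ^ 2)⁻¹ • x) ζ)
    (hPF : ‖ζ‖ ≤ d * ‖g‖) :
    (d ^ 2)⁻¹ * ‖ζ‖ ^ 2 + ‖g‖ ^ 2 + (d ^ 2 * ‖t₂‖ ^ 2 + ‖t₁‖ ^ 2)
      ≤ (229 / 100) ^ 2 * ((d ^ 2)⁻¹ * ‖x‖ ^ 2 + ‖s‖ ^ 2) := by
  have hd2 : 0 < d ^ 2 := by positivity
  have hk := (le_abs_self _).trans (abs_real_inner_le_norm ((d ^ 2)⁻¹ • x) ζ)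
  have hs := (le_abs_self _).trans (abs_real_inner_le_norm s g)
  have hnorm : ‖(d ^ 2)⁻¹ • x‖ = (d ^ 2)⁻¹ * ‖x‖ := by
    rw [norm_smul, Real.norm_of_nonneg (by positivity)]
  rw [ht₁, ht₂, @norm_sub_sq_real, hnorm]
  rw [real_inner_self_eq_norm_sq] at h
  rw [hnorm] at hk
  generalize (inner ℝ ((d ^ 2)⁻¹ • x) ζ : ℝ) = k at *
  generalize (inner ℝ s g : ℝ) = m at *
  have g0 : 0 ≤ ‖g‖ := norm_nonneg _
  have s0 : 0 ≤ ‖s‖ := norm_nonneg _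
  have z0 : 0 ≤ ‖ζ‖ := norm_nonneg _
  -- With `y = ‖x‖ / d` all factors of `d` disappear and a scalar inequality in `s`, `y`, `g`
  -- remains.
  have hy : ‖x‖ = d * (‖x‖ / d) := by field_simp
  have y0 : 0 ≤ ‖x‖ / d := by positivity
  generalize ‖x‖ / d = y at *
  rw [hy] at hk ⊢
  generalize ‖g‖ = g at *
  generalize ‖ζ‖ = ζ at *
  generalize ‖s‖ = s at *
  have q1 : (d ^ 2)⁻¹ * (d * y) ^ 2 = y ^ 2 := by field_simp
  have q2 : d ^ 2 * ((d ^ 2)⁻¹ * (d * y)) ^ 2 = y ^ 2 := by field_simp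
  have q3 : (d ^ 2)⁻¹ * ζ ^ 2 ≤ g ^ 2 := by
    rw [inv_mul_le_iff₀ hd2, ← mul_pow]
    exact pow_le_pow_left₀ z0 hPF 2
  have q4 : k ≤ y * g := by
    refine hk.trans ((mul_le_mul_of_nonneg_left hPF (by positivity)).trans_eq ?_)
    field_simp
  -- The energy identity gives `g² = m + k ≤ (s + y) g`.
  have q5 : g ≤ s + y := by
    by_contra! hlt
    nlinarith
  have q6 : y * g ≤ y * (s + y) := mul_le_mul_of_nonneg_left q5 y0
  have q7 : g ^ 2 ≤ (s + y) ^ 2 := pow_le_pow_left₀ g0 q5 2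
  rw [q1, q2]
  -- Eliminating `m = g² - k` and using `g ≤ s + y` leaves `2 s² + 4 s y + 4 y²`, a form with
  -- largest eigenvalue `3 + √5 < 5.2441 = 2.29²`. The square completes the difference in `s`, where
  -- `3.2441 = 5.2441 - 2`.
  nlinarith [sq_nonneg (3.2441 * s - 2 * y), sq_nonneg y]

end

theorem le_mul_of_sq_le_mul_sqrt {r c E I : ℝ} (hr : 0 ≤ r) (hE : 0 ≤ E) (hc : 0 ≤ c)
    (h : r ^ 2 ≤ E * √I) (hI : I ≤ c ^ 2 * r ^ 2) : r ≤ c * E := by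
  have e3 := Real.sqrt_le_sqrt hI
  rw [← mul_pow, Real.sqrt_sq (by positivity)] at e3
  have e4 := h.trans (mul_le_mul_of_nonneg_left e3 hE)
  rcases hr.eq_or_lt with hr | hr
  · rw [← hr]; positivity
  · nlinarith

theorem add_sub_sub_of_eq_zero {P Q a b c : ℝ} (ha : a = 0) (hb : b = 0) (h : P + Q = c) :
    P + Q - a - b = c := by
  rw [ha, hb, sub_zero, sub_zero, h]

/-- Tested with the conforming adjoint solution, the traces drop out and `b` equals the squared
field norm. That solution has norm at most `2.29` times the field norm, and one factor cancels. -/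
theorem normField_le {d : ℝ} (hd : 0 < d) (hPF : PoincareFriedrichs Ω d) {E : ℝ} (hE0 : 0 ≤ E)
    {u : TrialSpace hT} (hE : ∀ v, bilinB hT u v ≤ E * √(innerV T d v v)) :
    normField hT d u ≤ 229 / 100 * E := by
  obtain ⟨z, hz, τ, hτ1, hτ2, h⟩ := exists_poisson_hdiv hd hPF ((d ^ 2)⁻¹ • u.1) u.2.1
  have hb := hE (toBrokenH1 hT z, toBrokenHdiv hT τ)
  have hr2 : normField hT d u ^ 2 = (d ^ 2)⁻¹ * ‖u.1‖ ^ 2 + ‖u.2.1‖ ^ 2 :=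
    Real.sq_sqrt (by positivity)
  have e1 : bilinB hT u (toBrokenH1 hT z, toBrokenHdiv hT τ) = normField hT d u ^ 2 := by
    refine (bilinB_eq hT u (toBrokenH1 hT z, toBrokenHdiv hT τ)).trans
      (add_sub_sub_of_eq_zero (evalTrGrad_toBrokenHdiv hT u.2.2.1 τ)
        (evalTrDiv_toBrokenH1 hT u.2.2.2 hz) ?_)
    exact (congrArg₂ (· + ·) (pairHdiv_toBrokenHdiv hT u.1 u.2.1 τ)
      (pairH1_toBrokenH1 hT 0 u.2.1 z)).trans ((adjoint_solution_energy hτ1 hτ2).trans hr2.symm)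
  have e2 : innerV T d (toBrokenH1 hT z, toBrokenHdiv hT τ) (toBrokenH1 hT z, toBrokenHdiv hT τ)
      ≤ (229 / 100) ^ 2 * normField hT d u ^ 2 := by
    refine (innerV_self d (toBrokenH1 hT z, toBrokenHdiv hT τ)).le.trans ?_
    refine (congrArg₂ (· + ·) (sqH1_toBrokenH1 hT d z) (sqHdiv_toBrokenHdiv hT d τ)).le.trans ?_
    exact (adjoint_solution_le hd hτ1 hτ2 h (hPF z hz)).trans_eq
      (congrArg (fun t => (229 / 100) ^ 2 * t) hr2.symm)
  exact le_mul_of_sq_le_mul_sqrt (Real.sqrt_nonneg _) hE0 (by norm_num) (e1.symm.le.trans hb) e2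

end

/-! ### Control of the trace norms by broken test functions, and the inf-sup condition -/

section

variable {n : ℕ} {Ω : Set (Eu n)} {ι : Type*} [Fintype ι] {T : ι → Set (Eu n)}
  (hT : IsMesh Ω T)

section

variable {X Y : Type*} [NormedAddCommGroup X] [InnerProductSpace ℝ X] [NormedAddCommGroup Y]

theorem energy_neg_smul {c : ℝ} (hc : 0 < c) {x x' : X} (hx : x' = c • x) (g : Y) :
    c⁻¹ * ‖-x'‖ ^ 2 + ‖-g‖ ^ 2 = c * ‖x‖ ^ 2 + ‖g‖ ^ 2 := by
  rw [hx, norm_neg, norm_neg, norm_smul, Real.norm_of_nonneg hc.le]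
  field_simp

theorem inner_neg_smul_add_inner_neg [InnerProductSpace ℝ Y] {c : ℝ} {x x' : X} (hx : x' = c • x) (g : Y) :
    (inner ℝ x (-x') : ℝ) + inner ℝ g (-g) = -(c * ‖x‖ ^ 2 + ‖g‖ ^ 2) := by
  rw [hx, inner_neg_right, inner_neg_right, real_inner_smul_right, real_inner_self_eq_norm_sq,
    real_inner_self_eq_norm_sq, neg_add]

end

theorem IsMesh.sum_energy (c : ℝ) (a : L2 Ω) (b : L2v Ω) :
    ∑ i, (c * ‖restrictLp (hT.subset i) a‖ ^ 2 + ‖restrictLp (hT.subset i) b‖ ^ 2)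
      = c * ‖a‖ ^ 2 + ‖b‖ ^ 2 := by
  rw [← hT.sum_norm_restrictLp a, ← hT.sum_norm_restrictLp b, Finset.mul_sum,
    ← Finset.sum_add_distrib]

theorem le_add_of_sub_le_mul_sqrt {m r E P a I S : ℝ} (hm : 0 ≤ m) (hr : 0 ≤ r) (hE : 0 ≤ E)
    (h : P - a ≤ E * √I) (hI : I = m ^ 2) (ha : a = -m ^ 2) (hP : |P| ≤ r * √S) (hS : S = m ^ 2) :
    m ≤ r + E := by
  rw [hI, Real.sqrt_sq hm, ha] at h
  rw [hS, Real.sqrt_sq hm] at hP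
  have h1 := (neg_le_abs P).trans hP
  rcases hm.eq_or_lt with h0 | h0
  · rw [← h0]; positivity
  · nlinarith

theorem sqH1_zero (d : ℝ) : sqH1 T d 0 = 0 :=
  Finset.sum_eq_zero fun i _ => by
    have h : (d ^ 2)⁻¹ * ‖(0 : L2 (T i))‖ ^ 2 + ‖(0 : L2v (T i))‖ ^ 2 = 0 := by simp
    exact h

theorem sqHdiv_zero (d : ℝ) : sqHdiv T d 0 = 0 :=
  Finset.sum_eq_zero fun i _ => by
    have h : d ^ 2 * ‖(0 : L2 (T i))‖ ^ 2 + ‖(0 : L2v (T i))‖ ^ 2 = 0 := by simp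
    exact h

theorem add_zero_sub_sub_zero (x y : ℝ) : x + 0 - y - 0 = x - y := by ring

theorem zero_add_sub_zero_sub (x y : ℝ) : 0 + x - 0 - y = x - y := by ring

/-- Take `τ = -∇w` on each element, with `w` the minimum energy extension. Then `div τ = -d⁻² w`, so
`d² ‖div τ‖² = d⁻² ‖w‖²` and the norms of `τ` and `w` agree. The sign makes `-⟨û, τ⟩` positive in
`b`. -/
theorem exists_norming_broken_field {d : ℝ} (hd : 0 < d) (w₀ : TrGrad hT) :
    ∃ (m : ℝ) (τ : BrokenHdiv T), 0 ≤ m ∧ normTrGrad hT d w₀ ≤ m ∧ sqHdiv T d τ = m ^ 2 ∧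
      evalTrGrad hT w₀ τ = -m ^ 2 := by
  obtain ⟨w, hw, hdiv⟩ := exists_minimal_extension_grad hT hd w₀
  have hP : normH1 d w ^ 2 = (d ^ 2)⁻¹ * ‖w.1.1‖ ^ 2 + ‖w.1.2‖ ^ 2 :=
    Real.sq_sqrt (by positivity)
  have hc : 0 < (d ^ 2)⁻¹ := by positivity
  let τ : BrokenHdiv T := fun i => -⟨(restrictLp (hT.subset i) w.1.2,
    restrictLp (hT.subset i) ((d ^ 2)⁻¹ • w.1.1)), hdiv i⟩
  have hs : ∀ i, restrictLp (hT.subset i) ((d ^ 2)⁻¹ • w.1.1)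
      = (d ^ 2)⁻¹ • restrictLp (hT.subset i) w.1.1 := fun i => map_smul _ _ _
  have e1 : sqHdiv T d τ = normH1 d w ^ 2 := by
    refine Eq.trans (Finset.sum_congr rfl fun i _ => ?_)
      ((hT.sum_energy (d ^ 2)⁻¹ w.1.1 w.1.2).trans hP.symm)
    refine Eq.trans ?_ (energy_neg_smul hc (hs i) (restrictLp (hT.subset i) w.1.2))
    rw [inv_inv]
    rfl
  have e2 : pairHdiv hT w.1.1 w.1.2 τ = -normH1 d w ^ 2 := by
    refine Eq.trans (Finset.sum_congr rfl fun i _ =>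
      inner_neg_smul_add_inner_neg (hs i) (restrictLp (hT.subset i) w.1.2)) ?_
    exact (Finset.sum_neg_distrib _).trans
      (congrArg Neg.neg ((hT.sum_energy (d ^ 2)⁻¹ w.1.1 w.1.2).trans hP.symm))
  exact ⟨normH1 d w, τ, Real.sqrt_nonneg _, normTrGrad_le hT hw, e1,
    (evalTrGrad_eq hT hw τ).trans e2⟩

/-- With the norming field as test function, `m² = -⟨û, τ⟩` is `b` minus a field term; these are at
most `E m` and `r m`. -/
theorem normTrGrad_le_of_bilinB_le {d : ℝ} (hd : 0 < d) {E : ℝ} (hE0 : 0 ≤ E)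
    {u : TrialSpace hT} (hE : ∀ v, bilinB hT u v ≤ E * √(innerV T d v v)) :
    normTrGrad hT d u.2.2.1 ≤ normField hT d u + E :=
  (exists_norming_broken_field hT hd u.2.2.1).elim fun m h => h.elim fun τ h => by
    have hm := h.1
    have hle := h.2.1
    have e1 := h.2.2.1
    have e2 := h.2.2.2
    have e3 : innerV T d (0, τ) (0, τ) = m ^ 2 :=
      (innerV_self d (0, τ)).trans ((congrArg₂ (· + ·) (sqH1_zero d) e1).trans (zero_add _))
    have e4 : bilinB hT u (0, τ) = pairHdiv hT u.1 u.2.1 τ - evalTrGrad hT u.2.2.1 τ :=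
      (bilinB_eq hT u (0, τ)).trans ((congrArg₂ (fun x y => pairHdiv hT u.1 u.2.1 τ + x
        - evalTrGrad hT u.2.2.1 τ - y) (pairH1_zero hT 0 u.2.1) (evalTrDiv_zero hT u.2.2.2)).trans
        (add_zero_sub_sub_zero _ _))
    exact hle.trans (le_add_of_sub_le_mul_sqrt hm (Real.sqrt_nonneg _) hE0
      (e4.symm.le.trans (hE (0, τ))) e3 e2 (abs_pairHdiv_le hT hd u.1 u.2.1 τ) e1)

/-- Dually, `v = -d² div ρ` has elementwise gradient `-ρ` for the minimum energy extension `ρ`. -/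
theorem exists_norming_broken_function {d : ℝ} (hd : 0 < d) (ρ₀ : TrDiv hT) :
    ∃ (m : ℝ) (v : BrokenH1 T), 0 ≤ m ∧ normTrDiv hT d ρ₀ ≤ m ∧ sqH1 T d v = m ^ 2 ∧
      evalTrDiv hT ρ₀ v = -m ^ 2 := by
  obtain ⟨ρ, hρ, hgrad⟩ := exists_minimal_extension_div hT hd ρ₀
  have hP : normHdiv d ρ ^ 2 = d ^ 2 * ‖ρ.1.2‖ ^ 2 + ‖ρ.1.1‖ ^ 2 :=
    (Real.sq_sqrt (by positivity)).trans (add_comm _ _)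
  have hc : 0 < d ^ 2 := by positivity
  let v : BrokenH1 T := fun i => -⟨(restrictLp (hT.subset i) (d ^ 2 • ρ.1.2),
    restrictLp (hT.subset i) ρ.1.1), hgrad i⟩
  have hs : ∀ i, restrictLp (hT.subset i) (d ^ 2 • ρ.1.2)
      = d ^ 2 • restrictLp (hT.subset i) ρ.1.2 := fun i => map_smul _ _ _
  have e1 : sqH1 T d v = normHdiv d ρ ^ 2 := by
    refine Eq.trans (Finset.sum_congr rfl fun i _ => ?_)
      ((hT.sum_energy (d ^ 2) ρ.1.2 ρ.1.1).trans hP.symm)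
    exact energy_neg_smul hc (hs i) (restrictLp (hT.subset i) ρ.1.1)
  have e2 : pairH1 hT ρ.1.2 ρ.1.1 v = -normHdiv d ρ ^ 2 := by
    refine Eq.trans (Finset.sum_congr rfl fun i _ =>
      inner_neg_smul_add_inner_neg (hs i) (restrictLp (hT.subset i) ρ.1.1)) ?_
    exact (Finset.sum_neg_distrib _).trans
      (congrArg Neg.neg ((hT.sum_energy (d ^ 2) ρ.1.2 ρ.1.1).trans hP.symm))
  exact ⟨normHdiv d ρ, v, Real.sqrt_nonneg _, normTrDiv_le hT hρ, e1,
    (evalTrDiv_eq hT hρ v).trans e2⟩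

theorem normTrDiv_le_of_bilinB_le {d : ℝ} (hd : 0 < d) {E : ℝ} (hE0 : 0 ≤ E)
    {u : TrialSpace hT} (hE : ∀ v, bilinB hT u v ≤ E * √(innerV T d v v)) :
    normTrDiv hT d u.2.2.2 ≤ normField hT d u + E :=
  (exists_norming_broken_function hT hd u.2.2.2).elim fun m h => h.elim fun v h => by
    have hm := h.1
    have hle := h.2.1
    have e1 := h.2.2.1
    have e2 := h.2.2.2
    have e3 : innerV T d (v, 0) (v, 0) = m ^ 2 :=
      (innerV_self d (v, 0)).trans ((congrArg₂ (· + ·) e1 (sqHdiv_zero d)).trans (add_zero _))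
    have e4 : bilinB hT u (v, 0) = pairH1 hT 0 u.2.1 v - evalTrDiv hT u.2.2.2 v :=
      (bilinB_eq hT u (v, 0)).trans ((congrArg₂ (fun x y => x + pairH1 hT 0 u.2.1 v
        - y - evalTrDiv hT u.2.2.2 v) (pairHdiv_zero hT u.1 u.2.1)
        (evalTrGrad_zero hT u.2.2.1)).trans (zero_add_sub_zero_sub _ _))
    exact hle.trans (le_add_of_sub_le_mul_sqrt hm (Real.sqrt_nonneg _) hE0
      (e4.symm.le.trans (hE (v, 0))) e3 e2 (abs_pairH1_zero_le hT hd u v) e1)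

theorem sq_add_sq_add_sq_le {r p q E : ℝ} (hr0 : 0 ≤ r) (hp0 : 0 ≤ p) (hq0 : 0 ≤ q)
    (hr : r ≤ 229 / 100 * E) (hp : p ≤ r + E) (hq : q ≤ r + E) :
    r ^ 2 + p ^ 2 + q ^ 2 ≤ 27 * E ^ 2 := by
  have k1 := pow_le_pow_left₀ hr0 hr 2
  have k2 := pow_le_pow_left₀ hp0 (hp.trans (by linarith : r + E ≤ 329 / 100 * E)) 2
  have k3 := pow_le_pow_left₀ hq0 (hq.trans (by linarith : r + E ≤ 329 / 100 * E)) 2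
  have k4 : 0 ≤ E ^ 2 := sq_nonneg E
  -- The constants add up to `2.29² + 2 · 3.29² = 26.8923`.
  linarith

/-- Stability of the ultraweak formulation: the inf-sup condition with constant `27⁻¹ᐟ²`. -/
theorem normU_sq_le {d : ℝ} (hd : 0 < d) (hPF : PoincareFriedrichs Ω d) {E : ℝ} (hE0 : 0 ≤ E)
    {u : TrialSpace hT} (hE : ∀ v, bilinB hT u v ≤ E * √(innerV T d v v)) :
    normU hT d u ^ 2 ≤ 27 * E ^ 2 :=
  (normU_sq hT d u).le.trans (sq_add_sq_add_sq_le (Real.sqrt_nonneg _)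
    (normTrGrad_nonneg hT d u.2.2.1) (normTrDiv_nonneg hT d u.2.2.2)
    (normField_le hT hd hPF hE0 hE) (normTrGrad_le_of_bilinB_le hT hd hE0 hE)
    (normTrDiv_le_of_bilinB_le hT hd hE0 hE))

theorem eq_zero_of_normTrGrad_eq_zero {d : ℝ} (hd : 0 < d) {w₀ : TrGrad hT}
    (h : normTrGrad hT d w₀ = 0) : w₀ = 0 := by
  refine Subtype.ext (ContinuousLinearMap.ext fun τ => ?_)
  have k1 := neg_evalTrGrad_le hT hd w₀ τ
  have k2 := neg_evalTrGrad_le hT hd w₀ (-τ)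
  have k3 : evalTrGrad hT w₀ (-τ) = -evalTrGrad hT w₀ τ := map_neg w₀.1 τ
  rw [h, zero_mul] at k1 k2
  exact (by linarith : evalTrGrad hT w₀ τ = 0)

theorem eq_zero_of_normTrDiv_eq_zero {d : ℝ} (hd : 0 < d) {ρ₀ : TrDiv hT}
    (h : normTrDiv hT d ρ₀ = 0) : ρ₀ = 0 := by
  refine Subtype.ext (ContinuousLinearMap.ext fun v => ?_)
  have k1 := neg_evalTrDiv_le hT hd ρ₀ v
  have k2 := neg_evalTrDiv_le hT hd ρ₀ (-v)
  have k3 : evalTrDiv hT ρ₀ (-v) = -evalTrDiv hT ρ₀ v := map_neg ρ₀.1 v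
  rw [h, zero_mul] at k1 k2
  exact (by linarith : evalTrDiv hT ρ₀ v = 0)

theorem eq_zero_of_scaled_sq_eq_zero {X Y : Type*} [NormedAddCommGroup X] [NormedAddCommGroup Y]
    {d : ℝ} (hd : 0 < d) {x : X} {y : Y} {p q : ℝ}
    (h : √((d ^ 2)⁻¹ * ‖x‖ ^ 2 + ‖y‖ ^ 2 + p ^ 2 + q ^ 2) = 0) :
    x = 0 ∧ y = 0 ∧ p = 0 ∧ q = 0 := by
  have hc : 0 < (d ^ 2)⁻¹ := by positivity
  have h1 := (Real.sqrt_eq_zero (by positivity)).1 h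
  have f1 : 0 ≤ (d ^ 2)⁻¹ * ‖x‖ ^ 2 := by positivity
  have f2 := sq_nonneg ‖y‖
  have f3 := sq_nonneg p
  have f4 := sq_nonneg q
  refine ⟨norm_eq_zero.1 (pow_eq_zero_iff two_ne_zero |>.1
    ((mul_eq_zero.1 (by linarith : (d ^ 2)⁻¹ * ‖x‖ ^ 2 = 0)).resolve_left hc.ne')),
    norm_eq_zero.1 (pow_eq_zero_iff two_ne_zero |>.1 (by linarith)),
    pow_eq_zero_iff two_ne_zero |>.1 (by linarith), pow_eq_zero_iff two_ne_zero |>.1 (by linarith)⟩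

theorem eq_zero_of_normU_eq_zero {d : ℝ} (hd : 0 < d) {u : TrialSpace hT}
    (h : normU hT d u = 0) : u = 0 :=
  have h' := eq_zero_of_scaled_sq_eq_zero hd h
  Prod.ext h'.1 (Prod.ext h'.2.1 (Prod.ext (eq_zero_of_normTrGrad_eq_zero hT hd h'.2.2.1)
    (eq_zero_of_normTrDiv_eq_zero hT hd h'.2.2.2)))

theorem eq_zero_of_bilinB_le_zero {d : ℝ} (hd : 0 < d) (hPF : PoincareFriedrichs Ω d)
    {u : TrialSpace hT} (h : ∀ v, bilinB hT u v ≤ 0) : u = 0 := by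
  refine eq_zero_of_normU_eq_zero hT hd (pow_eq_zero_iff two_ne_zero |>.1
    (le_antisymm ?_ (sq_nonneg _)))
  have h1 := normU_sq_le hT hd hPF le_rfl (u := u) fun v => by rw [zero_mul]; exact h v
  rwa [zero_pow two_ne_zero, mul_zero] at h1

/-! ### Well-posedness -/

theorem inner_zero_add_inner {X Y : Type*} [NormedAddCommGroup X] [InnerProductSpace ℝ X]
    [NormedAddCommGroup Y] [InnerProductSpace ℝ Y] {z m f : X} (hz : z = 0) (hm : m = -f) (y : X)
    (s g : Y) : (inner ℝ z y : ℝ) + inner ℝ s g = inner ℝ m y + inner ℝ s g + inner ℝ f y := by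
  rw [hz, hm, inner_zero_left, inner_neg_left]
  ring

theorem pairH1_zero_eq_add_load (f : L2 Ω) (g : L2v Ω) (v : TestSpace T) :
    pairH1 hT 0 g v.1 = pairH1 hT (-f) g v.1 + load hT f v :=
  sum_eq_sum_add_sum fun i => inner_zero_add_inner (map_zero (restrictLp (hT.subset i)))
    (map_neg (restrictLp (hT.subset i)) f) (v.1 i).1.1 (restrictLp (hT.subset i) g) (v.1 i).1.2

theorem exists_isUltraweakSolution {d : ℝ} (hd : 0 < d) (hPF : PoincareFriedrichs Ω d)
    (f : L2 Ω) : ∃ u : TrialSpace hT, IsUltraweakSolution hT f u := by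
  -- With `c = 0` the field is `τ = -∇z` with `div τ = f`; hence `-τ = ∇z` serves as flux, with
  -- divergence `-f`, and its normal trace is `σ̂`.
  obtain ⟨z, hz, τ, hτ1, hτ2, -⟩ := exists_poisson_hdiv hd hPF f 0
  let w₀ : TrGrad hT := ⟨skelGrad hT z, z, hz, rfl⟩
  let ρ₀ : TrDiv hT := ⟨skelDiv hT (-τ), -τ, rfl⟩
  have h1 : (-τ).1.1 = z.1.2 := (congrArg Neg.neg hτ1).trans ((neg_sub 0 z.1.2).trans (sub_zero _))
  have h2 : (-τ).1.2 = -f := congrArg Neg.neg hτ2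
  refine ⟨(z.1.1, z.1.2, w₀, ρ₀), fun v => ?_⟩
  have e1 : evalTrGrad hT w₀ v.2 = pairHdiv hT z.1.1 z.1.2 v.2 := evalTrGrad_eq hT rfl v.2
  have e2 : evalTrDiv hT ρ₀ v.1 = pairH1 hT (-f) z.1.2 v.1 :=
    (evalTrDiv_eq hT (ρ := -τ) rfl v.1).trans (congrArg₂ (fun x y => pairH1 hT x y v.1) h2 h1)
  refine (bilinB_eq hT (z.1.1, z.1.2, w₀, ρ₀) v).trans ?_
  change pairHdiv hT z.1.1 z.1.2 v.2 + pairH1 hT 0 z.1.2 v.1 - evalTrGrad hT w₀ v.2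
    - evalTrDiv hT ρ₀ v.1 = load hT f v
  have e3 := pairH1_zero_eq_add_load hT f z.1.2 v
  linarith

theorem existsUnique_isUltraweakSolution {d : ℝ} (hd : 0 < d) (hPF : PoincareFriedrichs Ω d)
    (f : L2 Ω) : ∃! u : TrialSpace hT, IsUltraweakSolution hT f u := by
  obtain ⟨u, hu⟩ := exists_isUltraweakSolution hT hd hPF f
  refine ⟨u, hu, fun u' hu' => sub_eq_zero.1 (eq_zero_of_bilinB_le_zero hT hd hPF fun v => ?_)⟩
  have h : bilinBLin hT (u' - u) v = bilinBLin hT u' v - bilinBLin hT u v :=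
    congrFun (map_sub (bilinBLin hT) u' u) v
  have h1 : bilinBLin hT u' v = load hT f v := hu' v
  have h2 : bilinBLin hT u v = load hT f v := hu v
  exact (h.trans (sub_eq_zero.2 (h1.trans h2.symm))).le

theorem existsUnique_isOptimalTest {d : ℝ} (hd : 0 < d) (u : TrialSpace hT) :
    ∃! θ : TestSpace T, IsOptimalTest hT d u θ := by
  obtain ⟨θ, hθ⟩ := exists_isOptimalTest hT hd u
  exact ⟨θ, hθ, fun θ' hθ' => eq_of_forall_innerV_eq hd fun v => (hθ' v).trans (hθ v).symm⟩

theorem innerV_nonneg (d : ℝ) (v : TestSpace T) : 0 ≤ innerV T d v v :=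
  (add_nonneg (sqH1_nonneg d v.1) (sqHdiv_nonneg d v.2)).trans_eq (innerV_self d v).symm

/-- The trial norm is controlled by the energy norm. -/
theorem IsOptimalTest.normU_sq_le {d : ℝ} (hd : 0 < d) (hPF : PoincareFriedrichs Ω d)
    {u : TrialSpace hT} {θ : TestSpace T} (h : IsOptimalTest hT d u θ) :
    normU hT d u ^ 2 ≤ 27 * innerV T d θ θ := by
  have h1 := DPG.normU_sq_le hT hd hPF (Real.sqrt_nonneg (innerV T d θ θ)) (u := u)
    fun v => (h v).symm.le.trans (innerV_le hd θ v)
  rwa [Real.sq_sqrt (innerV_nonneg d θ)] at h1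

/-- The energy norm is controlled by the trial norm. -/
theorem IsOptimalTest.innerV_le {d : ℝ} (hd : 0 < d) {u : TrialSpace hT} {θ : TestSpace T}
    (h : IsOptimalTest hT d u θ) : innerV T d θ θ ≤ 3 * normU hT d u ^ 2 := by
  have h1 := (h θ).le.trans (bilinB_le hT hd u θ)
  have h2 := Real.sq_sqrt (innerV_nonneg d θ)
  have h3 : 0 ≤ 3 * normU hT d u ^ 2 := by positivity
  have h4 := Real.sq_sqrt h3
  have n1 := Real.sqrt_nonneg (innerV T d θ θ)
  have n2 := Real.sqrt_nonneg (3 * normU hT d u ^ 2)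
  generalize √(innerV T d θ θ) = s at *
  generalize √(3 * normU hT d u ^ 2) = t at *
  have h5 : s ≤ t := by
    rcases n1.eq_or_lt with h0 | h0
    · rw [← h0]; exact n2
    · refine le_of_mul_le_mul_right ?_ h0
      rw [← sq, h2]
      exact h1
  rw [← h2, ← h4]
  exact pow_le_pow_left₀ n1 h5 2

end

section

/-! ### Quasi-optimality of minimum residual methods -/

/-- The error passes from `N` to the energy norm at cost `C`, is compared there with any competitor
by best approximation, and returns at cost `c`. The loss is `κ = √(C c)`. -/
theorem existsUnique_minimal_residual {U V : Type*} [AddCommGroup U] [Module ℝ U]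
    (b : U →ₗ[ℝ] (V → ℝ)) (l : V → ℝ) (g : V → V → ℝ) (N : U → ℝ) (hN : ∀ u, 0 ≤ N u)
    (hN0 : ∀ u, N u = 0 → u = 0) (hsymm : ∀ v w, g v w = g w v) (hnonneg : ∀ v, 0 ≤ g v v)
    (hΘ : ∀ w, ∃! θ, ∀ v, g θ v = b w v) {c C κ : ℝ} (hC : 0 ≤ C)
    (hlower : ∀ w θ, (∀ v, g θ v = b w v) → N w ^ 2 ≤ C * g θ θ)
    (hupper : ∀ w θ, (∀ v, g θ v = b w v) → g θ θ ≤ c * N w ^ 2)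
    (hκ : 0 < κ) (hκ' : C * c = κ ^ 2)
    (Uh : Submodule ℝ U) [FiniteDimensional ℝ Uh] (hex : ∃! u, ∀ v, b u v = l v) :
    (∃! uh, uh ∈ Uh ∧ ∀ w ∈ Uh, ∀ θ, (∀ v, g θ v = b w v) → b uh θ = l θ) ∧
    ∀ u uh, (∀ v, b u v = l v) →
      (uh ∈ Uh ∧ ∀ w ∈ Uh, ∀ θ, (∀ v, g θ v = b w v) → b uh θ = l θ) →
      N (u - uh) ≤ κ * ⨅ w : Uh, N (u - w) := by
  choose Θ hΘ hΘ' using hΘ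
  have hgal := existsUnique_galerkin b g hsymm hnonneg Θ hΘ (fun w hw => by
      have h := hlower w _ (hΘ w)
      rw [hw, mul_zero] at h
      exact hN0 _ (pow_eq_zero_iff two_ne_zero |>.1 (le_antisymm h (sq_nonneg _)))) Uh
  -- Uniqueness of the optimal test function reduces the quantifier over `θ` to the chosen `Θ w`,
  -- and the exact solution replaces `l` by `b u`.
  have hiff : ∀ u, (∀ v, b u v = l v) → ∀ uh,
      (uh ∈ Uh ∧ ∀ w ∈ Uh, ∀ θ, (∀ v, g θ v = b w v) → b uh θ = l θ) ↔
      uh ∈ Uh ∧ ∀ w ∈ Uh, b uh (Θ w) = b u (Θ w) := by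
    intro u hu uh
    refine and_congr_right fun _ => ⟨fun h w hw => (h w hw _ (hΘ w)).trans (hu _).symm, ?_⟩
    intro h w hw θ hθ
    rw [hΘ' w θ hθ]
    exact (h w hw).trans (hu _)
  refine ⟨?_, ?_⟩
  · obtain ⟨u, hu, -⟩ := hex
    exact (existsUnique_congr (hiff u hu)).2 (hgal u).1
  · intro u uh hu huh
    obtain ⟨huh1, huh2⟩ := (hiff u hu uh).1 huh
    rw [← div_le_iff₀' hκ]
    refine le_ciInf fun w => ?_
    rw [div_le_iff₀' hκ]
    have h1 := (hgal u).2 uh huh1 huh2 w w.2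
    have h2 := hlower _ _ (hΘ (u - uh))
    have h3 := hupper _ _ (hΘ (u - w))
    refine (sq_le_sq₀ (hN _) (mul_nonneg hκ.le (hN _))).1 ?_
    rw [mul_pow, ← hκ', mul_assoc]
    exact h2.trans (mul_le_mul_of_nonneg_left (h1.trans h3) hC)

end

end DPG

end

/-- The constant comes from `27 · 3 = 9²`: the inf-sup bound times the continuity bound, both for
squared norms. -/
theorem mainTheorem1 {n : ℕ} {ι : Type*} [Fintype ι] {Ω : Set (DPG.Eu n)} {T : ι → Set (DPG.Eu n)}
    (hΩ : DPG.IsLipschitzDomain Ω) (hT : DPG.IsMesh Ω T)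
    {d : ℝ} (hd : 0 < d) (hPF : DPG.PoincareFriedrichs Ω d)
    (f : DPG.L2 Ω) (Uh : Submodule ℝ (DPG.TrialSpace hT)) [FiniteDimensional ℝ Uh] :
    (∃! u : DPG.TrialSpace hT, DPG.IsUltraweakSolution hT f u) ∧
    (∀ w : DPG.TrialSpace hT, ∃! θ : DPG.TestSpace T, DPG.IsOptimalTest hT d w θ) ∧
    (∃! uh : DPG.TrialSpace hT, DPG.IsDPGSolution hT d f Uh uh) ∧
    ∀ u uh : DPG.TrialSpace hT, DPG.IsUltraweakSolution hT f u →
      DPG.IsDPGSolution hT d f Uh uh →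
      DPG.normU hT d (u - uh) ≤ 9 * ⨅ w : Uh, DPG.normU hT d (u - w) :=
  have hex := DPG.existsUnique_isUltraweakSolution hT hd hPF f
  have hΘ := DPG.existsUnique_isOptimalTest hT hd
  ⟨hex, hΘ, DPG.existsUnique_minimal_residual (DPG.bilinBLin hT) (DPG.load hT f) (DPG.innerV T d)
    (DPG.normU hT d) (fun _ => Real.sqrt_nonneg _) (fun _ => DPG.eq_zero_of_normU_eq_zero hT hd)
    (DPG.innerV_comm d) (DPG.innerV_nonneg d) hΘ (c := 3) (C := 27) (by norm_num)
    (fun _ _ => DPG.IsOptimalTest.normU_sq_le hT hd hPF)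
    (fun _ _ => DPG.IsOptimalTest.innerV_le hT hd) (by norm_num) (by norm_num) Uh hex⟩
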